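/- **Setting.** Let $\mathcal W$ be a complete separable metric space, $\nu$ a $\sigma$-finite nonatomic Borel measure on $\mathcal W$, and $N$ a Poisson random measure on $\mathcal W$ with mean measure $\nu$: a random measure, defined on some probability space, such that $N(B)$ is Poisson with mean $\nu(B)$ whenever $\nu(B)<\infty$, and such that $N(B_1),\dots,N(B_k)$ are independent whenever $B_1,\dots,B_k$ are disjoint. Write $\mathcal P(dN|\nu)$ for its law on the space $\mathcal M$ of measures on $\mathcal W$, equipped with the $\sigma$-field generated by the maps $m\mapsto m(B)$. Let $n\ge 0$. For $\mathbf W=(W_1,\dots,W_n)\in\mathcal W^n$ let $\mathbf p=\{C_1,\dots,C_{n(\mathbf p)}\}$ be the partition of $\{1,\dots,n\}$ recording which of the $W_i$ are equal, let $W_1^*,\dots,W^*_{n(\mathbf p)}$ be the distinct values of $\mathbf W$, so that $C_j=\{i:W_i=W_j^*\}$, and let $\mathcal P(dN|\nu,\mathbf W)$ be the law of $N+\sum_{j=1}^{n(\mathbf p)}\delta_{W_j^*}$, where $N$ has law $\mathcal P(dN|\nu)$ and $\mathbf W$ is fixed. Let $\prod_{j=1}^{n(\mathbf p)}\nu(dW_j^*)$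 denote the measure on $\mathcal W^n$ which, for each partition $p$ of $\{1,\dots,n\}$, restricts on the set of tuples whose partition of ties is $p$ to the image of the product measure $\prod_{C\in p}\nu(dv_C)$, restricted to families $(v_C)_{C\in p}$ of distinct points, under the map $W_i=v_C$ for $i\in C$. **Proposition 2.2.** The map $m\mapsto m^{\otimes n}$ is almost everywhere measurable with respect to $\mathcal P(dN|\nu)$, $\mathcal P(dN|\nu,\mathbf W)$ is a probability kernel from $\mathcal W^n$ to $\mathcal M$, and the following disintegration of measures on $\mathcal W^n\times\mathcal M$ holds: $$\Big[\prod_{i=1}^n N(dW_i)\Big]\mathcal P(dN|\nu)=\mathcal P(dN|\nu,\mathbf W)\prod_{j=1}^{n(\mathbf p)}\nu(dW_j^*).$$ For every $\mathbf W\in\mathcal W^n$, $\mathcal P(dN|\nu,\mathbf W)$ is the unique probability measure $Q$ on $\mathcal M$ with $$\int_{\mathcal M}e^{-N(f)}\,Q(dN)=\exp\Big(-\int_{\mathcal W}(1-e^{-f(w)})\,\nu(dw)\Big)\prod_{j=1}^{n(\mathbf p)}e^{-f(W_j^*)}$$ for all nonnegative Borel functions $f$ on $\mathcal W$ with bounded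 support, where $N(f)=\int f\,dN$ and $e^{-\infty}=0$. The $n$-th moment measure $M(d\mathbf W|\nu)=\int_{\mathcal M}\big[\prod_{i=1}^n N(dW_i)\big]\mathcal P(dN|\nu)$ is $\sigma$-finite and $$M(d\mathbf W|\nu)=\prod_{j=1}^{n(\mathbf p)}\nu(dW_j^*)=\nu(dW_1)\prod_{i=2}^n\Big[\nu(dW_i)+\sum_{j=1}^{n(\mathbf p_{i-1})}\delta_{W_j^*}(dW_i)\Big],$$ where $\mathbf p_{i-1}$ is the partition of $\{1,\dots,i-1\}$ recording the ties among $W_1,\dots,W_{i-1}$, and in the $i$-th factor $W_1^*,\dots,W^*_{n(\mathbf p_{i-1})}$ are the distinct values of $W_1,\dots,W_{i-1}$. Moreover, for all measurable $g_1,\dots,g_n:\mathcal W\to[0,\infty]$, $$\int_{\mathcal M}\prod_{i=1}^n\Big[\int_{\mathcal W}g_i\,dN\Big]\mathcal P(dN|\nu)=\sum_{p}\prod_{C\in p}\int_{\mathcal W}\Big[\prod_{i\in C}g_i(w)\Big]\nu(dw),$$ the sum running over all partitions $p$ of $\{1,\dots,n\}$. -/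

import Mathlib

open MeasureTheory ProbabilityTheory
open scoped ENNReal NNReal

namespace PoissonPartition

/-- `N` is a Poisson random measure on `W` with mean measure `ν`, defined on `(Ω, μ)`: a measurable
map into the space of measures on `W` (with the sigma-field generated by the evaluations `m ↦ m B`)
such that `N(B)` is Poisson with mean `ν(B)` whenever `ν(B)` is finite, and such that the values on
disjoint sets are independent.

No finiteness on bounded sets is imposed. If `ν` is finite on bounded sets then almost surely so is
`N`, and the sigma-field on the subspace of boundedly finite measures is the trace of the one used
here. -/
structure IsPoissonRandomMeasure {Ω W : Type*} [MeasurableSpace Ω] [MeasurableSpace W]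
    (N : Ω → Measure W) (ν : Measure W) (μ : Measure Ω) : Prop where
  measurable : Measurable N
  map_apply : ∀ B : Set W, MeasurableSet B → ν B ≠ ∞ →
    μ.map (fun ω => N ω B) = (poissonMeasure (ν B).toNNReal).map (fun k : ℕ => (k : ℝ≥0∞))
  indep : ∀ (k : ℕ) (B : Fin k → Set W), (∀ i, MeasurableSet (B i)) →
    Pairwise (Function.onFun Disjoint B) → iIndepFun (fun i ω => N ω (B i)) μ

/-- The measure `[∏ᵢ N(dWᵢ)] P(dN)` on `Wⁿ × {measures on W}`, for a law `P` of a random measure: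
`N` has law `P` and, given `N`, the tuple is governed by the `n`-fold product of `N`. -/
noncomputable def jointMeasure {W : Type*} [MeasurableSpace W] (n : ℕ) (P : Measure (Measure W)) :
    Measure ((Fin n → W) × Measure W) :=
  P.bind fun m => (Measure.pi fun _ : Fin n => m).map fun w => (w, m)

/-- The `n`-th moment measure `M(dW) = ∫ [∏ᵢ N(dWᵢ)] P(dN)` on `Wⁿ`. -/
noncomputable def momentMeasure {W : Type*} [MeasurableSpace W] (n : ℕ) (P : Measure (Measure W)) :
    Measure (Fin n → W) :=
  P.bind fun m => Measure.pi fun _ : Fin n => m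

/-- The measure `K(dN | W) M(dW)` on `Wⁿ × {measures on W}`. -/
noncomputable def disintegration {W : Type*} [MeasurableSpace W] {n : ℕ}
    (M : Measure (Fin n → W)) (K : (Fin n → W) → Measure (Measure W)) :
    Measure ((Fin n → W) × Measure W) :=
  M.bind fun w => (K w).map fun m => (w, m)

open Classical in
/-- The set `{W₁*, W₂*, …}` of distinct values of the tuple `W`. -/
noncomputable def distinctValues {W : Type*} {n : ℕ} (w : Fin n → W) : Finset W :=
  Finset.univ.image w

/-- `∑ⱼ δ_{Wⱼ*}`, the sum running over the distinct values of the tuple. -/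
noncomputable def tieMeasure {W : Type*} [MeasurableSpace W] {n : ℕ} (w : Fin n → W) : Measure W :=
  ∑ x ∈ distinctValues w, Measure.dirac x

/-- The law `P(dN | W)` of `N + ∑ⱼ δ_{Wⱼ*}`, where `N` has law `P` and the tuple `W` is fixed. -/
noncomputable def palmLaw {W : Type*} [MeasurableSpace W] {n : ℕ} (P : Measure (Measure W))
    (w : Fin n → W) : Measure (Measure W) :=
  P.map fun m => m + tieMeasure w

/-- The tuple in `Wⁿ` with value `v C` at every index of the cell `C` of the partition `p`. -/
def spread {W : Type*} {n : ℕ} (p : Finpartition (Finset.univ : Finset (Fin n)))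
    (v : p.parts → W) : Fin n → W :=
  fun i => v ⟨p.part i, p.part_mem.2 (Finset.mem_univ i)⟩

/-- The measure `∏ⱼ ν(dWⱼ*)` on `Wⁿ` in the coordinates `(W*, p)`: on the tuples whose partition of
ties is `p` it is the image of the product of one copy of `ν` for each cell of `p`, restricted to
families of distinct points; these pieces are added up over all partitions `p` of the index set. -/
noncomputable def partitionMeasure {W : Type*} [MeasurableSpace W] (ν : Measure W) (n : ℕ) :
    Measure (Fin n → W) :=
  ∑ p : Finpartition (Finset.univ : Finset (Fin n)),
    ((Measure.pi fun _ : p.parts => ν).restrict {v | Function.Injective v}).map (spread p)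

/-- The sequential measure `ν(dW₁) ∏_{i=2}^n [ν(dWᵢ) + ∑ⱼ δ_{Wⱼ*}(dWᵢ)]` on `Wⁿ`, where the sum in
the `i`-th factor runs over the distinct values of `W₁, …, Wᵢ₋₁`. -/
noncomputable def urnMeasure {W : Type*} [MeasurableSpace W] (ν : Measure W) :
    (n : ℕ) → Measure (Fin n → W)
  | 0 => Measure.dirac Fin.elim0
  | n + 1 => (urnMeasure ν n).bind fun w =>
      (ν + tieMeasure w).map fun x => (Fin.snoc w x : Fin (n + 1) → W)

/-- `e^{-t}` for `t ∈ [0, ∞]`, with `e^{-∞} = 0`. -/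
noncomputable def expNeg (t : ℝ≥0∞) : ℝ≥0∞ := EReal.exp (-(t : EReal))

/-- The Laplace functional `∫ e^{-N(f)} Q(dN)` of the law `Q` of a random measure. -/
noncomputable def laplace {W : Type*} [MeasurableSpace W] (Q : Measure (Measure W)) (f : W → ℝ≥0) :
    ℝ≥0∞ :=
  ∫⁻ m, expNeg (∫⁻ x, f x ∂m) ∂Q

/-- The nonnegative Borel functions with bounded support. -/
def BMPos (W : Type*) [PseudoMetricSpace W] [MeasurableSpace W] : Set (W → ℝ≥0) :=
  {f | Measurable f ∧ Bornology.IsBounded (Function.support f)}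

end PoissonPartition

namespace PoissonPartition

/-! Everything rests on the Laplace functional. On the level sets of a simple function the masses
are independent Poisson variables, and monotone approximation extends the product of their
transforms to all measurable `f` (`IsPoissonRandomMeasure.lintegral_expNeg`). Conversely, a Laplace
functional determines a finite measure on the space of measures (`ext_of_laplace`), which also gives
the uniqueness of the Palm law.

Differentiating the functional at `f` in the direction of the indicator of `A` gives E[N(A)
e^{-N(f)}] = ∫_A e^{-f} dν · E e^{-N(f)}. Thus N(A) P(dN) and the ν|_A-mixture of the laws of N +
δ_x have the same Laplace functional, so they agree; this is the Mecke equation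
(`IsPoissonLaw.mecke`).

Iterating Mecke (`IsPoissonLaw.lintegral_piKernel`) yields the disintegration in sequential form.
Once w has been sampled, N has become N + `tieMeasure w`. The next point comes either from N, and is
then new because ν has no atoms, or from `tieMeasure w`, and then repeats an old value. Applied to a
product of integrals, Mecke instead gives the recursion that splits a set partition by the cell of
one element (`IsPoissonLaw.lintegral_prod_lintegral`). With indicators this evaluates the moment
measure on boxes, which identifies it with the partition form.

A Poisson measure is σ-finite only almost surely, so the kernels `evalKernel` and `piKernel` are cut
off outside an almost sure set. -/

/-! ### The function e^{-t} on [0, ∞] -/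

@[simp] lemma expNeg_coe (x : ℝ≥0) : expNeg x = ENNReal.ofReal (Real.exp (-x)) := by
  have : (-((x : ℝ≥0∞) : EReal)) = ((-(x : ℝ) : ℝ) : EReal) := by
    rw [EReal.coe_neg]; rfl
  rw [expNeg, this, EReal.exp_coe]

@[simp] lemma expNeg_top : expNeg ∞ = 0 := by simp [expNeg]

@[simp] lemma expNeg_zero : expNeg 0 = 1 := by simp [expNeg]

lemma expNeg_add (s t : ℝ≥0∞) : expNeg (s + t) = expNeg s * expNeg t := by
  induction s with
  | top => simp
  | coe s =>
    induction t with
    | top => simp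
    | coe t =>
      rw [← ENNReal.coe_add, expNeg_coe, expNeg_coe, expNeg_coe, ← ENNReal.ofReal_mul (by positivity),
        ← Real.exp_add]
      congr 2
      push_cast
      ring

lemma expNeg_sum {ι : Type*} (s : Finset ι) (f : ι → ℝ≥0∞) :
    expNeg (∑ i ∈ s, f i) = ∏ i ∈ s, expNeg (f i) := by
  classical
  induction s using Finset.induction_on with
  | empty => simp
  | insert a s ha ih => rw [Finset.sum_insert ha, Finset.prod_insert ha, expNeg_add, ih]

lemma expNeg_natCast_mul (k : ℕ) (t : ℝ≥0∞) : expNeg (k * t) = expNeg t ^ k := by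
  induction k with
  | zero => simp
  | succ k ih => rw [Nat.cast_succ, add_mul, one_mul, expNeg_add, ih, pow_succ]

lemma expNeg_strictAnti : StrictAnti expNeg := by
  intro s t h
  apply EReal.exp_strictMono
  rw [EReal.neg_lt_neg_iff]
  exact_mod_cast h

lemma expNeg_antitone : Antitone expNeg := expNeg_strictAnti.antitone

lemma expNeg_le_one (t : ℝ≥0∞) : expNeg t ≤ 1 := by
  simpa using expNeg_antitone (bot_le (a := t))

lemma expNeg_ne_top (t : ℝ≥0∞) : expNeg t ≠ ∞ :=
  ne_top_of_le_ne_top ENNReal.one_ne_top (expNeg_le_one t)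

lemma continuous_expNeg : Continuous expNeg := by
  unfold expNeg
  exact ENNReal.continuous_exp.comp (continuous_neg.comp continuous_coe_ennreal_ereal)

@[fun_prop]
lemma measurable_expNeg : Measurable expNeg := continuous_expNeg.measurable

/-! ### Laplace transforms and functionals determine measures -/

/-- The bounded continuous function `x ↦ e^{-∑ⱼ kⱼ xⱼ}` on a power of `[0, ∞]`. -/
noncomputable def expNegMonomial {J : Type*} [Fintype J] (k : J → ℕ) :
    BoundedContinuousFunction (J → ℝ≥0∞) ℝ :=
  BoundedContinuousFunction.ofNormedAddCommGroup (fun x => ∏ j, (expNeg (x j)).toReal ^ k j)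
    (continuous_finsetProd _ fun j _ => Continuous.pow
      ((ENNReal.continuousOn_toReal.comp_continuous continuous_expNeg expNeg_ne_top).comp
        (continuous_apply j)) _) 1
    (fun x => by
      rw [Real.norm_of_nonneg (by positivity)]
      exact Finset.prod_le_one (fun _ _ => by positivity) fun j _ =>
        pow_le_one₀ (by positivity)
          (by simpa using ENNReal.toReal_mono ENNReal.one_ne_top (expNeg_le_one (x j))))

lemma expNegMonomial_apply {J : Type*} [Fintype J] (k : J → ℕ) (x : J → ℝ≥0∞) :
    expNegMonomial k x = (expNeg (∑ j, k j * x j)).toReal := by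
  simp [expNegMonomial, expNeg_sum, expNeg_natCast_mul, ENNReal.toReal_prod]

lemma expNegMonomial_add {J : Type*} [Fintype J] (k l : J → ℕ) :
    expNegMonomial (k + l) = expNegMonomial k * expNegMonomial l := by
  ext x
  simp [expNegMonomial, pow_add, Finset.prod_mul_distrib]

lemma expNegMonomial_zero {J : Type*} [Fintype J] :
    expNegMonomial (0 : J → ℕ) = 1 := by
  ext x
  simp [expNegMonomial]

/-- A finite measure on a finite power of `[0, ∞]` is determined by its Laplace transform at
integer points. -/
theorem ext_of_lintegral_expNeg_natCast {J : Type*} [Fintype J] {P Q : Measure (J → ℝ≥0∞)}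
    [IsFiniteMeasure P] [IsFiniteMeasure Q]
    (h : ∀ k : J → ℕ, ∫⁻ x, expNeg (∑ j, k j * x j) ∂P = ∫⁻ x, expNeg (∑ j, k j * x j) ∂Q) :
    P = Q := by
  -- Products of monomials are monomials, so the algebra they generate is their linear span, and
  -- integrals need comparing only on monomials.
  let S : Submonoid (BoundedContinuousFunction (J → ℝ≥0∞) ℝ) :=
    { carrier := Set.range expNegMonomial
      one_mem' := ⟨0, expNegMonomial_zero⟩
      mul_mem' := by
        rintro _ _ ⟨k, rfl⟩ ⟨l, rfl⟩
        exact ⟨k + l, expNegMonomial_add k l⟩ }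
  let A : StarSubalgebra ℝ (BoundedContinuousFunction (J → ℝ≥0∞) ℝ) :=
    { Algebra.adjoin ℝ (S : Set (BoundedContinuousFunction (J → ℝ≥0∞) ℝ)) with
      star_mem' := fun {a} ha => by
        have : star a = a := by ext; simp
        rwa [this] }
  have hmem : ∀ k, expNegMonomial k ∈ A := fun k => Algebra.subset_adjoin ⟨k, rfl⟩
  refine ext_of_forall_mem_subalgebra_integral_eq_of_polish (𝕜 := ℝ) (A := A) ?_ ?_
  · intro x y hxy
    obtain ⟨j, hj⟩ := Function.ne_iff.1 hxy
    classical
    -- A single coordinate suffices to separate points, since `expNeg` is injective on all of [0,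
    -- ∞].
    refine ⟨_, ⟨_, ⟨expNegMonomial (Pi.single j 1), hmem _, rfl⟩, rfl⟩, ?_⟩
    have key : ∀ z : J → ℝ≥0∞,
        expNegMonomial (Pi.single j 1) z = (expNeg (z j)).toReal := fun z => by
      rw [expNegMonomial_apply, Finset.sum_eq_single j] <;> simp +contextual
    change expNegMonomial (Pi.single j 1) x ≠ expNegMonomial (Pi.single j 1) y
    rw [key, key]
    intro he
    exact hj (expNeg_strictAnti.injective
      ((ENNReal.toReal_eq_toReal_iff' (expNeg_ne_top _) (expNeg_ne_top _)).1 he))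
  · intro g hg
    replace hg : g ∈ Submodule.span ℝ (S : Set (BoundedContinuousFunction (J → ℝ≥0∞) ℝ)) := by
      have : g ∈ Algebra.adjoin ℝ (S : Set (BoundedContinuousFunction (J → ℝ≥0∞) ℝ)) := hg
      rwa [← Subalgebra.mem_toSubmodule, Algebra.adjoin_eq_span, Submonoid.closure_eq] at this
    induction hg using Submodule.span_induction with
    | mem f hf =>
      obtain ⟨k, rfl⟩ := hf
      have hm : Measurable fun x : J → ℝ≥0∞ => expNeg (∑ j, k j * x j) :=
        measurable_expNeg.comp (by fun_prop)
      simp_rw [expNegMonomial_apply]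
      rw [integral_toReal hm.aemeasurable (.of_forall fun x => (expNeg_ne_top _).lt_top),
        integral_toReal hm.aemeasurable (.of_forall fun x => (expNeg_ne_top _).lt_top), h]
    | zero => simp
    | add f g _ _ hf hg =>
      have hi : ∀ (R : Measure (J → ℝ≥0∞)) [IsFiniteMeasure R]
        (f : BoundedContinuousFunction (J → ℝ≥0∞) ℝ), Integrable f R := fun R _ f => f.integrable R
      simp only [BoundedContinuousFunction.coe_add, Pi.add_apply]
      rw [integral_add (hi _ _) (hi _ _), integral_add (hi _ _) (hi _ _), hf, hg]
    | smul a f _ hf =>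
      simp only [BoundedContinuousFunction.coe_smul]
      rw [integral_smul, integral_smul, hf]

/-- The sigma-field on the space of measures is generated by the evaluations at bounded sets. -/
lemma measurable_measure_of_isBounded {W α : Type*} [PseudoMetricSpace W] [MeasurableSpace W]
    [OpensMeasurableSpace W] {_ : MeasurableSpace α} {g : α → Measure W}
    (hg : ∀ B : Set W, MeasurableSet B → Bornology.IsBounded B → Measurable fun a => g a B) :
    Measurable g := by
  rcases isEmpty_or_nonempty W with hW | ⟨⟨x₀⟩⟩
  · exact measurable_of_subsingleton_codomain g
  refine Measure.measurable_of_measurable_coe _ fun s hs => ?_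
  have hB : (fun a => g a s) = fun a => ⨆ n : ℕ, g a (s ∩ Metric.ball x₀ n) := by
    funext a
    rw [← Monotone.measure_iUnion]
    · rw [← Set.inter_iUnion, Metric.iUnion_ball_nat, Set.inter_univ]
    · exact fun i j hij => Set.inter_subset_inter_right _
        (Metric.ball_subset_ball (by exact_mod_cast hij))
  rw [hB]
  exact Measurable.iSup fun n => hg _ (hs.inter measurableSet_ball)
    (Metric.isBounded_ball.subset Set.inter_subset_right)

/-- A finite measure on the space of measures is determined by its Laplace functional. -/
theorem ext_of_laplace {W : Type*} [PseudoMetricSpace W] [MeasurableSpace W]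
    [OpensMeasurableSpace W] {P Q : Measure (Measure W)} [IsFiniteMeasure P] [IsFiniteMeasure Q]
    (h : ∀ f ∈ BMPos W, laplace P f = laplace Q f) : P = Q := by
  -- The law is recovered from the joint laws of m(B₁), …, m(B_k) for bounded B_j. Their transform
  -- at the integer point k is the Laplace functional at ∑ k_j 1_{B_j}.
  let I := {B : Set W // MeasurableSet B ∧ Bornology.IsBounded B}
  let Φ : Measure W → I → ℝ≥0∞ := fun m B => m B
  have hΦ : Measurable Φ := measurable_pi_lambda _ fun B => Measure.measurable_coe B.2.1
  have hmap : P.map Φ = Q.map Φ := by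
    have hlim : ∀ R : Measure (Measure W), IsProjectiveLimit (R.map Φ)
        (fun J : Finset I => (R.map Φ).map J.restrict) := fun R J => rfl
    refine (hlim P).unique (P := fun J : Finset I => (P.map Φ).map J.restrict) fun J => ?_
    symm
    refine ext_of_lintegral_expNeg_natCast fun k => ?_
    have hk : ∀ R : Measure (Measure W),
        ∫⁻ x, expNeg (∑ j, k j * x j) ∂((R.map Φ).map J.restrict) =
          laplace R (fun w => ∑ j, Set.indicator (j.1.1 : Set W) (fun _ => (k j : ℝ≥0)) w) := by
      intro R
      have hm : Measurable fun x : J → ℝ≥0∞ => expNeg (∑ j, k j * x j) :=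
        measurable_expNeg.comp (by fun_prop)
      rw [lintegral_map hm (Finset.measurable_restrict J),
        lintegral_map (f := fun y : I → ℝ≥0∞ => expNeg (∑ j, k j * J.restrict y j))
          (hm.comp (Finset.measurable_restrict (X := fun _ : I => ℝ≥0∞) J)) hΦ, laplace]
      refine lintegral_congr fun m => ?_
      congr 1
      simp only [ENNReal.ofNNReal_finsetSum]
      rw [lintegral_finsetSum]
      · refine Finset.sum_congr rfl fun j _ => ?_
        simp only [ENNReal.coe_indicator]
        rw [lintegral_indicator_const j.1.2.1]
        rfl
      · intro j _
        exact (measurable_const.indicator j.1.2.1).coe_nnreal_ennreal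
    rw [hk, hk]
    refine h _ ⟨Finset.measurable_fun_sum _ fun j _ => measurable_const.indicator j.1.2.1, ?_⟩
    refine ((Bornology.isBounded_iUnion (s := fun j : J => (j.1.1 : Set W))).2
      fun j => j.1.2.2).subset fun w hw => ?_
    by_contra hcon
    apply hw
    refine Finset.sum_eq_zero fun j _ => Set.indicator_of_notMem (fun hj => hcon ?_) _
    exact Set.mem_iUnion.2 ⟨j, hj⟩
  ext s hs
  -- Every measurable set of measures is a preimage under `Φ`, so equality of the images suffices.
  have hid : Measurable[MeasurableSpace.comap Φ inferInstance] (id : Measure W → Measure W) :=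
    measurable_measure_of_isBounded fun B hB hB' =>
      (measurable_pi_apply (⟨B, hB, hB'⟩ : I)).comp (comap_measurable Φ)
  obtain ⟨t, ht, hts⟩ := hid hs
  rw [Set.preimage_id] at hts
  rw [← hts]
  rw [← Measure.map_apply hΦ ht, hmap, Measure.map_apply hΦ ht]

/-! ### The Laplace functional of a Poisson random measure -/

/-- The probability generating function of the Poisson distribution. -/
lemma lintegral_pow_poissonMeasure (r x : ℝ≥0) :
    ∫⁻ k : ℕ, (x : ℝ≥0∞) ^ k ∂poissonMeasure r = ENNReal.ofReal (Real.exp (r * (x - 1))) := by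
  rw [lintegral_countable']
  simp_rw [poissonMeasure_singleton]
  have h := (NormedSpace.expSeries_div_hasSum_exp ((r : ℝ) * x)).mul_left (Real.exp (-r))
  rw [← Real.exp_eq_exp_ℝ, ← Real.exp_add] at h
  have h2 : (r : ℝ) * (x - 1) = -r + r * x := by ring
  rw [h2, ← h.tsum_eq, ENNReal.ofReal_tsum_of_nonneg (fun n => by positivity) h.summable]
  refine tsum_congr fun k => ?_
  rw [← ENNReal.ofReal_coe_nnreal (p := x), ← ENNReal.ofReal_pow (NNReal.coe_nonneg x),
    ← ENNReal.ofReal_mul (by positivity)]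
  congr 1
  rw [mul_pow]
  ring

lemma measurable_expNeg_lintegral {W : Type*} [MeasurableSpace W] {f : W → ℝ≥0∞}
    (hf : Measurable f) : Measurable fun m : Measure W => expNeg (∫⁻ x, f x ∂m) :=
  measurable_expNeg.comp (Measure.measurable_lintegral hf)

lemma one_sub_expNeg_coe (x : ℝ≥0) : 1 - expNeg x = ENNReal.ofReal (1 - Real.exp (-x)) := by
  rw [expNeg_coe, ENNReal.ofReal_sub _ (by positivity), ENNReal.ofReal_one]

/-- The Laplace transform of the Poisson distribution. -/
lemma lintegral_expNeg_poissonMeasure (r : ℝ≥0) (c : ℝ≥0∞) :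
    ∫⁻ k : ℕ, expNeg (c * k) ∂poissonMeasure r = expNeg (r * (1 - expNeg c)) := by
  obtain ⟨x, hx⟩ := WithTop.ne_top_iff_exists.1 (expNeg_ne_top c)
  replace hx : (x : ℝ≥0∞) = expNeg c := hx
  have hx1 : x ≤ 1 := by
    have := expNeg_le_one c
    rw [← hx] at this
    exact_mod_cast this
  have h1 : (r : ℝ≥0∞) * (1 - expNeg c) = ((r * (1 - x) : ℝ≥0) : ℝ≥0∞) := by
    rw [← hx]; push_cast; rfl
  simp_rw [mul_comm c, expNeg_natCast_mul, ← hx]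
  rw [lintegral_pow_poissonMeasure, hx, h1, expNeg_coe]
  congr 2
  rw [NNReal.coe_mul, NNReal.coe_sub hx1]
  push_cast
  ring

section PoissonRandomMeasure

variable {Ω W : Type*} [MeasurableSpace Ω] [MeasurableSpace W] {N : Ω → Measure W} {ν : Measure W}
  {μ : Measure Ω}

lemma IsPoissonRandomMeasure.measurable_apply (hN : IsPoissonRandomMeasure N ν μ) {B : Set W}
    (hB : MeasurableSet B) : Measurable fun ω => N ω B :=
  (Measure.measurable_coe hB).comp hN.measurable

lemma IsPoissonRandomMeasure.lintegral_comp_apply (hN : IsPoissonRandomMeasure N ν μ) {B : Set W}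
    (hB : MeasurableSet B) (hνB : ν B ≠ ∞) {g : ℝ≥0∞ → ℝ≥0∞} (hg : Measurable g) :
    ∫⁻ ω, g (N ω B) ∂μ = ∫⁻ k : ℕ, g k ∂poissonMeasure (ν B).toNNReal := by
  rw [← lintegral_map hg (hN.measurable_apply hB), hN.map_apply B hB hνB,
    lintegral_map hg .of_discrete]

/-- Since k ≤ 2^k, the mean is bounded by the generating function at 2; its exact value is not
needed. -/
lemma IsPoissonRandomMeasure.lintegral_apply_ne_top (hN : IsPoissonRandomMeasure N ν μ) {B : Set W}
    (hB : MeasurableSet B) (hνB : ν B ≠ ∞) : ∫⁻ m, m B ∂(μ.map N) ≠ ∞ := by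
  rw [lintegral_map (Measure.measurable_coe hB) hN.measurable,
    hN.lintegral_comp_apply hB hνB (g := fun t => t) measurable_id]
  refine ne_top_of_le_ne_top (b := ∫⁻ k : ℕ, ((2 : ℝ≥0) : ℝ≥0∞) ^ k
    ∂poissonMeasure (ν B).toNNReal) ?_ (lintegral_mono fun k => ?_)
  · rw [lintegral_pow_poissonMeasure]
    exact ENNReal.ofReal_ne_top
  · have : k ≤ 2 ^ k := Nat.lt_two_pow_self.le
    simpa using (by exact_mod_cast this : (k : ℝ≥0∞) ≤ 2 ^ k)

/-- The level sets are disjoint, so the expectation factors into Poisson transforms. Cutting down to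
`B` gives every level set, including that of the value 0, finite mean. -/
lemma IsPoissonRandomMeasure.lintegral_expNeg_simpleFunc (hN : IsPoissonRandomMeasure N ν μ)
    {B : Set W} (hB : MeasurableSet B) (hνB : ν B ≠ ∞) (s : SimpleFunc W ℝ≥0∞) :
    ∫⁻ ω, expNeg (∫⁻ x in B, s x ∂(N ω)) ∂μ = expNeg (∫⁻ x in B, (1 - expNeg (s x)) ∂ν) := by
  have hm : ∀ c, MeasurableSet (s ⁻¹' {c} ∩ B) := fun c => (s.measurableSet_fiber c).inter hB
  have hmeas : ∀ (m : Measure W) c, m.restrict B (s ⁻¹' {c}) = m (s ⁻¹' {c} ∩ B) := fun m c =>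
    Measure.restrict_apply (s.measurableSet_fiber c)
  have h1 : ∀ m : Measure W, ∫⁻ x in B, s x ∂m = ∑ c ∈ s.range, c * m (s ⁻¹' {c} ∩ B) := fun m => by
    rw [SimpleFunc.lintegral_eq_lintegral]
    simp_rw [SimpleFunc.lintegral, hmeas]
  have h2 : ∫⁻ x in B, (1 - expNeg (s x)) ∂ν =
      ∑ c ∈ s.range, (1 - expNeg c) * ν (s ⁻¹' {c} ∩ B) := by
    have := (s.map fun c => 1 - expNeg c).lintegral_eq_lintegral (ν.restrict B)
    rw [SimpleFunc.map_lintegral] at this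
    simp_rw [hmeas] at this
    exact this
  simp_rw [h1, h2, expNeg_sum]
  have hfin : ∀ c, ν (s ⁻¹' {c} ∩ B) ≠ ∞ := fun c => measure_ne_top_of_subset Set.inter_subset_right hνB
  let e := s.range.equivFin
  have hind : iIndepFun (fun i ω => N ω (s ⁻¹' {((e.symm i : s.range) : ℝ≥0∞)} ∩ B)) μ := by
    refine hN.indep _ _ (fun i => hm _) fun i j hij => ?_
    refine Disjoint.mono Set.inter_subset_left Set.inter_subset_left ?_
    refine Disjoint.preimage _ (Set.disjoint_singleton.2 fun h => hij ?_)
    exact e.symm.injective (Subtype.ext h)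
  have hre : ∀ F : ℝ≥0∞ → ℝ≥0∞, ∏ c ∈ s.range, F c = ∏ i, F (e.symm i) := fun F => by
    rw [← Finset.prod_coe_sort, ← e.symm.prod_comp]
  simp_rw [hre]
  have hg : ∀ i, Measurable fun t : ℝ≥0∞ => expNeg ((e.symm i : s.range) * t) := fun i =>
    measurable_expNeg.comp (by fun_prop)
  refine (lintegral_prod_eq_prod_lintegral_of_indepFun _ _ (hind.comp _ hg)
    fun i => (hg i).comp (hN.measurable_apply (hm _))).trans ?_
  refine Finset.prod_congr rfl fun i _ => ?_
  refine (hN.lintegral_comp_apply (hm _) (hfin _) (hg i)).trans ?_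
  rw [lintegral_expNeg_poissonMeasure, ENNReal.coe_toNNReal (hfin _), mul_comm]

/-- The Laplace functional of a Poisson random measure. -/
theorem IsPoissonRandomMeasure.lintegral_expNeg [SigmaFinite ν] [IsProbabilityMeasure μ]
    (hN : IsPoissonRandomMeasure N ν μ) {f : W → ℝ≥0∞} (hf : Measurable f) :
    ∫⁻ m, expNeg (∫⁻ x, f x ∂m) ∂(μ.map N) = expNeg (∫⁻ x, (1 - expNeg (f x)) ∂ν) := by
  rw [lintegral_map (measurable_expNeg_lintegral hf) hN.measurable]
  let B := spanningSets ν
  have hB : ∀ n, MeasurableSet (B n) := measurableSet_spanningSets ν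
  -- Simple functions cut off to sets of finite measure, increasing to `f`. The expectations
  -- converge by domination by 1, the exponents by monotone convergence.
  let g : ℕ → W → ℝ≥0∞ := fun n => (B n).indicator (SimpleFunc.eapprox f n)
  have hgm : ∀ n, Measurable (g n) := fun n => (SimpleFunc.measurable _).indicator (hB n)
  have hg_mono : Monotone g := fun i j hij x =>
    (Set.indicator_le_indicator_of_subset (monotone_spanningSets ν hij) (fun _ => bot_le) x).trans
      (Set.indicator_le_indicator (SimpleFunc.monotone_eapprox f hij x))
  have hg_lim : ∀ x, Filter.Tendsto (fun n => g n x) Filter.atTop (nhds (f x)) := fun x => by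
    refine (SimpleFunc.tendsto_eapprox hf x).congr' ?_
    filter_upwards [Filter.eventually_ge_atTop (spanningSetsIndex ν x)] with n hn
    exact (Set.indicator_of_mem (monotone_spanningSets ν hn (mem_spanningSetsIndex ν x)) _).symm
  have hone : Measurable fun t : ℝ≥0∞ => 1 - expNeg t := measurable_const.sub measurable_expNeg
  have hcont : Continuous fun t : ℝ≥0∞ => 1 - expNeg t :=
    (ENNReal.continuous_sub_left ENNReal.one_ne_top).comp continuous_expNeg
  have hanti : Monotone fun t : ℝ≥0∞ => 1 - expNeg t := fun s t h =>
    tsub_le_tsub_left (expNeg_antitone h) 1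
  have hn : ∀ n, ∫⁻ ω, expNeg (∫⁻ x, g n x ∂(N ω)) ∂μ = expNeg (∫⁻ x, (1 - expNeg (g n x)) ∂ν) := by
    intro n
    have h2 : ∀ x, 1 - expNeg (g n x) =
        (B n).indicator (fun x => 1 - expNeg (SimpleFunc.eapprox f n x)) x := fun x => by
      by_cases hx : x ∈ B n <;> simp [g, hx]
    simp_rw [h2]
    rw [lintegral_indicator (hB n), ← hN.lintegral_expNeg_simpleFunc (hB n)
      (measure_spanningSets_lt_top ν n).ne]
    simp_rw [g, lintegral_indicator (hB n)]
  have hl1 : Filter.Tendsto (fun n => ∫⁻ ω, expNeg (∫⁻ x, g n x ∂(N ω)) ∂μ) Filter.atTop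
      (nhds (∫⁻ ω, expNeg (∫⁻ x, f x ∂(N ω)) ∂μ)) := by
    refine tendsto_lintegral_of_dominated_convergence (fun _ => 1)
      (fun n => (measurable_expNeg_lintegral (hgm n)).comp hN.measurable)
      (fun n => .of_forall fun ω => expNeg_le_one _) (by simp) (.of_forall fun ω => ?_)
    refine (continuous_expNeg.tendsto _).comp ?_
    exact lintegral_tendsto_of_tendsto_of_monotone (fun n => (hgm n).aemeasurable)
      (.of_forall fun x i j h => hg_mono h x) (.of_forall hg_lim)
  have hl2 : Filter.Tendsto (fun n => expNeg (∫⁻ x, (1 - expNeg (g n x)) ∂ν)) Filter.atTop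
      (nhds (expNeg (∫⁻ x, (1 - expNeg (f x)) ∂ν))) := by
    refine (continuous_expNeg.tendsto _).comp ?_
    exact lintegral_tendsto_of_tendsto_of_monotone (fun n => (hone.comp (hgm n)).aemeasurable)
      (.of_forall fun x i j h => hanti (hg_mono h x))
      (.of_forall fun x => (hcont.tendsto _).comp (hg_lim x))
  exact tendsto_nhds_unique hl1 (hl2.congr fun n => (hn n).symm)

end PoissonRandomMeasure

/-! ### Differentiating the Laplace functional -/

lemma tendsto_mul_of_hasDerivAt_zero {h : ℝ → ℝ} {a : ℝ} (hd : HasDerivAt h a 0) (h0 : h 0 = 0) :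
    Filter.Tendsto (fun n : ℕ => ((n : ℝ) + 1) * h (((n : ℝ) + 1)⁻¹)) Filter.atTop (nhds a) := by
  have h1 : Filter.Tendsto (fun n : ℕ => ((n : ℝ) + 1)⁻¹) Filter.atTop
      (nhdsWithin 0 {0}ᶜ) := by
    refine tendsto_nhdsWithin_iff.2 ⟨?_, .of_forall fun n => ?_⟩
    · simpa using tendsto_one_div_add_atTop_nhds_zero_nat (𝕜 := ℝ)
    · have : (0 : ℝ) < ((n : ℝ) + 1)⁻¹ := by positivity
      exact this.ne'
  refine (hd.tendsto_slope_zero.comp h1).congr fun n => ?_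
  simp [h0]

lemma one_sub_expNeg_le (t : ℝ≥0∞) : 1 - expNeg t ≤ t := by
  induction t with
  | top => simp
  | coe x =>
    rw [one_sub_expNeg_coe, ← ENNReal.ofReal_coe_nnreal]
    exact ENNReal.ofReal_le_ofReal (by linarith [Real.add_one_le_exp (-(x : ℝ))])

/-- Domination of the difference quotients at step 1/(n+1): with y = m(A) the bound is integrable.
-/
lemma mul_one_sub_expNeg_le (n : ℕ) (y : ℝ≥0∞) :
    ((n : ℝ≥0∞) + 1) * (1 - expNeg (((n : ℝ≥0∞) + 1)⁻¹ * y)) ≤ y := by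
  refine (mul_le_mul_right (one_sub_expNeg_le _) _).trans ?_
  rw [← mul_assoc, ENNReal.mul_inv_cancel (by simp) (by finiteness), one_mul]

lemma natCast_add_one_inv_eq_coe (n : ℕ) :
    ((n : ℝ≥0∞) + 1)⁻¹ = (((n : ℝ≥0) + 1)⁻¹ : ℝ≥0) := by
  rw [ENNReal.coe_inv (by positivity)]
  push_cast
  rfl

lemma tendsto_mul_one_sub_expNeg (x : ℝ≥0) :
    Filter.Tendsto (fun n : ℕ => ((n : ℝ≥0∞) + 1) * (1 - expNeg (((n : ℝ≥0∞) + 1)⁻¹ * x)))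
      Filter.atTop (nhds x) := by
  have hd : HasDerivAt (fun t : ℝ => 1 - Real.exp (-(t * x))) x 0 := by
    have h1 : HasDerivAt (fun t : ℝ => -(t * x)) (-x) 0 := by
      simpa using ((hasDerivAt_id (0 : ℝ)).mul_const (x : ℝ)).fun_neg
    simpa using h1.exp.const_sub 1
  have := ENNReal.tendsto_ofReal (tendsto_mul_of_hasDerivAt_zero hd (by simp))
  rw [ENNReal.ofReal_coe_nnreal] at this
  refine this.congr fun n => ?_
  rw [natCast_add_one_inv_eq_coe, ← ENNReal.coe_mul, one_sub_expNeg_coe,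
    ENNReal.ofReal_mul (by positivity)]
  congr 1
  rw [ENNReal.ofReal_add (by positivity) (by positivity)]
  simp

/-- The quotient on the explicit side of the perturbed Laplace identity, where a = ∫_A e^{-f} dν. -/
lemma tendsto_mul_one_sub_expNeg_one_sub (a : ℝ≥0) :
    Filter.Tendsto (fun n : ℕ => ((n : ℝ≥0∞) + 1) *
      (1 - expNeg ((1 - expNeg (((n : ℝ≥0∞) + 1)⁻¹)) * a))) Filter.atTop (nhds a) := by
  have hd : HasDerivAt (fun t : ℝ => 1 - Real.exp (-((1 - Real.exp (-t)) * a))) a 0 := by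
    have h0 : HasDerivAt (fun t : ℝ => 1 - Real.exp (-t)) 1 0 := by
      simpa using (hasDerivAt_id (0 : ℝ)).neg.exp.const_sub 1
    have h1 : HasDerivAt (fun t : ℝ => -((1 - Real.exp (-t)) * a)) (-a) 0 := by
      simpa using (h0.mul_const (a : ℝ)).fun_neg
    simpa using h1.exp.const_sub 1
  have := ENNReal.tendsto_ofReal (tendsto_mul_of_hasDerivAt_zero hd (by simp))
  rw [ENNReal.ofReal_coe_nnreal] at this
  refine this.congr fun n => ?_
  have hnn : 0 ≤ 1 - Real.exp (-((n : ℝ) + 1)⁻¹) := by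
    have : Real.exp (-((n : ℝ) + 1)⁻¹) ≤ 1 := Real.exp_le_one_iff.2 (by
      rw [neg_nonpos]; positivity)
    linarith
  have h1 : (1 - expNeg (((n : ℝ≥0∞) + 1)⁻¹)) * a =
      ((Real.toNNReal (1 - Real.exp (-((n : ℝ) + 1)⁻¹)) * a : ℝ≥0) : ℝ≥0∞) := by
    rw [natCast_add_one_inv_eq_coe, one_sub_expNeg_coe, ENNReal.coe_mul]
    simp [ENNReal.ofReal]
  rw [h1, one_sub_expNeg_coe, ENNReal.ofReal_mul (by positivity), NNReal.coe_mul,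
    Real.coe_toNNReal _ hnn]
  congr 1
  rw [ENNReal.ofReal_add (by positivity) (by positivity)]
  simp

section LaplaceDerivative

variable {W : Type*} [MeasurableSpace W]

/-- `P` has the Laplace functional and the finite intensities of a Poisson random measure with mean
measure `ν`. -/
structure IsPoissonLaw (P : Measure (Measure W)) (ν : Measure W) : Prop where
  lintegral_expNeg : ∀ f : W → ℝ≥0∞, Measurable f →
    ∫⁻ m, expNeg (∫⁻ x, f x ∂m) ∂P = expNeg (∫⁻ x, (1 - expNeg (f x)) ∂ν)
  lintegral_apply_ne_top : ∀ B : Set W, MeasurableSet B → ν B ≠ ∞ → ∫⁻ m, m B ∂P ≠ ∞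

lemma IsPoissonRandomMeasure.isPoissonLaw {Ω : Type*} [MeasurableSpace Ω] {N : Ω → Measure W}
    {ν : Measure W} {μ : Measure Ω} [SigmaFinite ν] [IsProbabilityMeasure μ]
    (hN : IsPoissonRandomMeasure N ν μ) : IsPoissonLaw (μ.map N) ν :=
  ⟨fun _ hf => hN.lintegral_expNeg hf, fun _ hB hνB => hN.lintegral_apply_ne_top hB hνB⟩

variable {P : Measure (Measure W)} {ν : Measure W}

lemma IsPoissonLaw.ae_apply_lt_top (hP : IsPoissonLaw P ν) {B : Set W} (hB : MeasurableSet B)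
    (hνB : ν B ≠ ∞) : ∀ᵐ m ∂P, m B < ∞ :=
  ae_lt_top (Measure.measurable_coe hB) (hP.lintegral_apply_ne_top B hB hνB)

/-- The difference of the Laplace functionals at f and f + t 1_A. The exponent splits because 1 -
e^{-f - t 1_A} = (1 - e^{-f}) + 1_A (1 - e^{-t}) e^{-f}. -/
lemma IsPoissonLaw.lintegral_one_sub_mul [IsProbabilityMeasure P] (hP : IsPoissonLaw P ν) {A : Set W}
    (hA : MeasurableSet A) {f : W → ℝ≥0∞} (hf : Measurable f) (t : ℝ≥0∞) :
    ∫⁻ m, (1 - expNeg (t * m A)) * expNeg (∫⁻ x, f x ∂m) ∂P =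
      (1 - expNeg ((1 - expNeg t) * ∫⁻ x in A, expNeg (f x) ∂ν)) *
        ∫⁻ m, expNeg (∫⁻ x, f x ∂m) ∂P := by
  have hE := measurable_expNeg_lintegral hf
  have hmA : Measurable fun m : Measure W => m A := Measure.measurable_coe hA
  have hu : Measurable fun m : Measure W => expNeg (t * m A) :=
    measurable_expNeg.comp (hmA.const_mul t)
  have hprod : ∀ m : Measure W, expNeg (t * m A) * expNeg (∫⁻ x, f x ∂m) =
      expNeg (∫⁻ x, (f x + A.indicator (fun _ => t) x) ∂m) := fun m => by
    rw [lintegral_add_left hf, lintegral_indicator_const hA, add_comm, expNeg_add]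
  have hsplit : ∀ x, 1 - expNeg (f x + A.indicator (fun _ => t) x) =
      (1 - expNeg (f x)) + A.indicator (fun x => (1 - expNeg t) * expNeg (f x)) x := fun x => by
    by_cases hx : x ∈ A
    · simp only [hx, Set.indicator_of_mem]
      rw [expNeg_add, ENNReal.sub_mul (fun _ _ => expNeg_ne_top _), one_mul, mul_comm (expNeg t),
        tsub_add_tsub_cancel (expNeg_le_one _)]
      exact mul_le_of_le_one_right' (expNeg_le_one _)
    · simp [hx]
  have hone : Measurable fun x => 1 - expNeg (f x) :=
    measurable_const.sub (measurable_expNeg.comp hf)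
  have hint : ∫⁻ m, expNeg (t * m A) * expNeg (∫⁻ x, f x ∂m) ∂P =
      expNeg ((1 - expNeg t) * ∫⁻ x in A, expNeg (f x) ∂ν) *
        ∫⁻ m, expNeg (∫⁻ x, f x ∂m) ∂P := by
    simp_rw [hprod]
    have hsum : Measurable fun x => f x + A.indicator (fun _ => t) x :=
      hf.add (measurable_const.indicator hA)
    rw [hP.lintegral_expNeg _ hsum, hP.lintegral_expNeg _ hf, ← expNeg_add]
    have hEf : Measurable fun x => expNeg (f x) := measurable_expNeg.comp hf
    simp_rw [hsplit]
    rw [lintegral_add_left hone, lintegral_indicator hA,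
      lintegral_const_mul _ hEf, add_comm]
  have hsub : ∀ u e : ℝ≥0∞, e ≠ ∞ → (1 - u) * e = e - u * e := fun u e he => by
    rw [ENNReal.sub_mul (fun _ _ => he), one_mul]
  have hfin : ∫⁻ m, expNeg (∫⁻ x, f x ∂m) ∂P ≠ ∞ := by
    rw [hP.lintegral_expNeg _ hf]
    exact expNeg_ne_top _
  have huE : Measurable fun m : Measure W => expNeg (t * m A) * expNeg (∫⁻ x, f x ∂m) := hu.mul hE
  rw [hsub _ _ hfin, ← hint, ← lintegral_sub huE]
  · exact lintegral_congr fun m => hsub _ _ (expNeg_ne_top _)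
  · rw [hint]
    exact ENNReal.mul_ne_top (expNeg_ne_top _) hfin
  · exact .of_forall fun m => mul_le_of_le_one_left' (expNeg_le_one _)

/-- The derivative of the Laplace functional in the direction of an indicator function. -/
lemma IsPoissonLaw.lintegral_apply_mul_expNeg [IsProbabilityMeasure P] (hP : IsPoissonLaw P ν)
    {A : Set W} (hA : MeasurableSet A) (hνA : ν A ≠ ∞) {f : W → ℝ≥0∞} (hf : Measurable f) :
    ∫⁻ m, m A * expNeg (∫⁻ x, f x ∂m) ∂P =
      (∫⁻ x in A, expNeg (f x) ∂ν) * ∫⁻ m, expNeg (∫⁻ x, f x ∂m) ∂P := by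
  have hE := measurable_expNeg_lintegral hf
  have hmA : Measurable fun m : Measure W => m A := Measure.measurable_coe hA
  have ha : ∫⁻ x in A, expNeg (f x) ∂ν ≠ ∞ := by
    refine ne_top_of_le_ne_top hνA ((lintegral_mono fun x => expNeg_le_one _).trans ?_)
    simp
  have hl1 : Filter.Tendsto (fun n : ℕ => ∫⁻ m, ((n : ℝ≥0∞) + 1) *
      (1 - expNeg (((n : ℝ≥0∞) + 1)⁻¹ * m A)) * expNeg (∫⁻ x, f x ∂m) ∂P) Filter.atTop
      (nhds (∫⁻ m, m A * expNeg (∫⁻ x, f x ∂m) ∂P)) := by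
    refine tendsto_lintegral_of_dominated_convergence (fun m => m A) (fun n => ?_)
      (fun n => .of_forall fun m => ?_) (hP.lintegral_apply_ne_top A hA hνA) ?_
    · exact ((measurable_const.sub (measurable_expNeg.comp (hmA.const_mul _))).const_mul _).mul hE
    · exact (mul_le_of_le_one_right' (expNeg_le_one _)).trans (mul_one_sub_expNeg_le n _)
    · filter_upwards [hP.ae_apply_lt_top hA hνA] with m hm
      refine ENNReal.Tendsto.mul_const ?_ (Or.inr (expNeg_ne_top _))
      lift m A to ℝ≥0 using hm.ne with y
      exact tendsto_mul_one_sub_expNeg y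
  have hl2 : Filter.Tendsto (fun n : ℕ => ((n : ℝ≥0∞) + 1) *
      (1 - expNeg ((1 - expNeg (((n : ℝ≥0∞) + 1)⁻¹)) * ∫⁻ x in A, expNeg (f x) ∂ν)) *
        ∫⁻ m, expNeg (∫⁻ x, f x ∂m) ∂P) Filter.atTop
      (nhds ((∫⁻ x in A, expNeg (f x) ∂ν) * ∫⁻ m, expNeg (∫⁻ x, f x ∂m) ∂P)) := by
    refine ENNReal.Tendsto.mul_const ?_ (Or.inr ?_)
    · lift (∫⁻ x in A, expNeg (f x) ∂ν) to ℝ≥0 using ha with a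
      exact tendsto_mul_one_sub_expNeg_one_sub a
    · rw [hP.lintegral_expNeg _ hf]
      exact expNeg_ne_top _
  refine tendsto_nhds_unique hl1 (hl2.congr fun n => ?_)
  simp_rw [mul_assoc ((n : ℝ≥0∞) + 1)]
  have hm : Measurable fun m : Measure W =>
      (1 - expNeg (((n : ℝ≥0∞) + 1)⁻¹ * m A)) * expNeg (∫⁻ x, f x ∂m) :=
    (measurable_const.sub (measurable_expNeg.comp (hmA.const_mul _))).mul hE
  rw [lintegral_const_mul _ hm, hP.lintegral_one_sub_mul hA hf]

@[fun_prop]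
lemma measurable_add_dirac : Measurable fun p : W × Measure W => p.2 + Measure.dirac p.1 :=
  measurable_snd.add (Measure.measurable_dirac.comp measurable_fst)

end LaplaceDerivative

/-! ### The Mecke equation -/

section Mecke

variable {W : Type*} [MeasurableSpace W] {P : Measure (Measure W)} {ν : Measure W}

/-- The measures that are finite on each of the sets `spanningSets ν k`. -/
def finiteOnSpanningSets (ν : Measure W) [SigmaFinite ν] : Set (Measure W) :=
  {m | ∀ k, m (spanningSets ν k) < ∞}

lemma measurableSet_finiteOnSpanningSets (ν : Measure W) [SigmaFinite ν] :
    MeasurableSet (finiteOnSpanningSets ν) := by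
  rw [finiteOnSpanningSets, Set.ofPred_forall]
  exact MeasurableSet.iInter fun k =>
    measurableSet_lt (Measure.measurable_coe (measurableSet_spanningSets ν k)) measurable_const

lemma IsPoissonLaw.ae_mem_finiteOnSpanningSets [SigmaFinite ν] (hP : IsPoissonLaw P ν) :
    ∀ᵐ m ∂P, m ∈ finiteOnSpanningSets ν :=
  ae_all_iff.2 fun k => hP.ae_apply_lt_top (measurableSet_spanningSets ν k)
    (measure_spanningSets_lt_top ν k).ne

lemma sigmaFinite_of_mem_finiteOnSpanningSets [SigmaFinite ν] {m : Measure W}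
    (hm : m ∈ finiteOnSpanningSets ν) : SigmaFinite m :=
  ⟨⟨⟨spanningSets ν, fun _ => trivial, hm, iUnion_spanningSets ν⟩⟩⟩

lemma add_mem_finiteOnSpanningSets [SigmaFinite ν] {m m' : Measure W}
    (hm : m ∈ finiteOnSpanningSets ν) [IsFiniteMeasure m'] : m + m' ∈ finiteOnSpanningSets ν :=
  fun k => by
    rw [Measure.add_apply]
    exact ENNReal.add_lt_top.2 ⟨hm k, measure_lt_top _ _⟩

open Classical in
/-- The kernel `m ↦ m`, cut off to zero where `m` is not finite on the sets `spanningSets ν k`. -/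
noncomputable def evalKernel (ν : Measure W) [SigmaFinite ν] : Kernel (Measure W) W :=
  Kernel.piecewise (measurableSet_finiteOnSpanningSets ν) ⟨id, measurable_id⟩ 0

lemma evalKernel_apply [SigmaFinite ν] {m : Measure W} (hm : m ∈ finiteOnSpanningSets ν) :
    evalKernel ν m = m := by
  classical
  rw [evalKernel, Kernel.piecewise_apply, if_pos hm]
  rfl

lemma evalKernel_apply_of_notMem [SigmaFinite ν] {m : Measure W} (hm : m ∉ finiteOnSpanningSets ν) :
    evalKernel ν m = 0 := by
  classical
  rw [evalKernel, Kernel.piecewise_apply, if_neg hm]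
  rfl

/-- No uniform bound on m(D k) exists, so the kernel is cut along disjoint pieces `D k` of the space
and along the integer part j of m(D k); each resulting piece has mass at most j + 1. -/
instance [SigmaFinite ν] : IsSFiniteKernel (evalKernel ν) := by
  classical
  let D : ℕ → Set W := disjointed (spanningSets ν)
  have hD : ∀ k, MeasurableSet (D k) := .disjointed (measurableSet_spanningSets ν)
  have hDfin : ∀ m ∈ finiteOnSpanningSets ν, ∀ k, m (D k) < ∞ := fun m hm k =>
    (measure_mono (disjointed_subset _ _)).trans_lt (hm k)
  have hS : ∀ k j : ℕ, MeasurableSet {m : Measure W | ⌊(m (D k)).toReal⌋₊ = j} := fun k j =>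
    (Nat.measurable_floor.comp (Measure.measurable_coe (hD k)).ennreal_toReal)
      (measurableSet_singleton j)
  let κ : ℕ → ℕ → Kernel (Measure W) W := fun k j =>
    Kernel.piecewise (hS k j) ((evalKernel ν).restrict (hD k)) 0
  have hκfin : ∀ k j, IsFiniteKernel (κ k j) := fun k j => by
    refine ⟨⟨j + 1, by finiteness, fun m => ?_⟩⟩
    simp only [κ, Kernel.piecewise_apply]
    split_ifs with h
    · rw [Kernel.restrict_apply, Measure.restrict_apply_univ]
      -- An infinite mass has real value 0, so its floor bounds nothing; but at such m the kernel
      -- vanishes.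
      by_cases hm : m ∈ finiteOnSpanningSets ν
      · rw [evalKernel_apply hm, ← ENNReal.ofReal_toReal (hDfin m hm k).ne]
        have h2 := (Nat.lt_floor_add_one (m (D k)).toReal).le
        rw [Set.mem_ofPred_eq] at h
        rw [h] at h2
        refine (ENNReal.ofReal_le_ofReal h2).trans ?_
        rw [ENNReal.ofReal_add (by positivity) (by positivity)]
        simp
      · simp [evalKernel_apply_of_notMem hm]
    · simp
  have hsum : evalKernel ν = Kernel.sum fun k => Kernel.sum fun j => κ k j := by
    ext m : 1
    rw [Kernel.sum_apply]
    simp_rw [Kernel.sum_apply]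
    have hin : ∀ k, Measure.sum (fun j => κ k j m) = (evalKernel ν m).restrict (D k) := fun k => by
      ext s hs
      rw [Measure.sum_apply _ hs, tsum_eq_single ⌊(m (D k)).toReal⌋₊]
      · simp [κ, Kernel.piecewise_apply, Kernel.restrict_apply]
      · intro j hj
        simp [κ, Kernel.piecewise_apply, hj.symm]
    simp_rw [hin]
    rw [← Measure.restrict_iUnion (disjoint_disjointed _) hD, iUnion_disjointed,
      iUnion_spanningSets, Measure.restrict_univ]
  rw [hsum]
  have : ∀ k, IsSFiniteKernel (Kernel.sum fun j => κ k j) := fun k =>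
    inferInstance
  infer_instance

/-- Both sides are finite measures evaluated at `E`, and the derivative formula says that their
Laplace functionals agree. This is Mecke for the indicator of A × E. -/
lemma IsPoissonLaw.lintegral_apply_mul_indicator [PseudoMetricSpace W] [OpensMeasurableSpace W]
    [SigmaFinite ν] [IsProbabilityMeasure P] (hP : IsPoissonLaw P ν)
    {A : Set W} (hA : MeasurableSet A) (hνA : ν A ≠ ∞) {E : Set (Measure W)}
    (hE : MeasurableSet E) :
    ∫⁻ m in E, m A ∂P = ∫⁻ x in A, P {m | m + Measure.dirac x ∈ E} ∂ν := by
  have hmA : Measurable fun m : Measure W => m A := Measure.measurable_coe hA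
  let Q₁ : Measure (Measure W) := P.withDensity fun m => m A
  let Q₂ : Measure (Measure W) := ((ν.restrict A).prod P).map fun p => p.2 + Measure.dirac p.1
  have : IsFiniteMeasure Q₁ := isFiniteMeasure_withDensity (hP.lintegral_apply_ne_top A hA hνA)
  have : IsFiniteMeasure (ν.restrict A) := ⟨by simpa using hνA.lt_top⟩
  have : IsFiniteMeasure Q₂ := inferInstance
  have hQ : Q₁ = Q₂ := by
    refine ext_of_laplace fun f hf => ?_
    have hf' : Measurable fun x => (f x : ℝ≥0∞) := hf.1.coe_nnreal_ennreal
    have hL := measurable_expNeg_lintegral hf'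
    have hEf : Measurable fun x => expNeg (f x) := measurable_expNeg.comp hf'
    rw [laplace, lintegral_withDensity_eq_lintegral_mul _ hmA hL, laplace,
      lintegral_map hL measurable_add_dirac]
    refine Eq.trans ?_ (lintegral_prod _ (hL.comp measurable_add_dirac).aemeasurable).symm
    simp only [Pi.mul_apply, Function.comp_apply]
    rw [hP.lintegral_apply_mul_expNeg hA hνA hf',
      ← lintegral_mul_const _ hEf]
    refine lintegral_congr fun x => ?_
    rw [← lintegral_const_mul _ hL]
    refine lintegral_congr fun m => ?_
    rw [lintegral_add_measure, lintegral_dirac' _ hf', expNeg_add, mul_comm]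
  have h := congrArg (fun Q => Q E) hQ
  simp only [Q₁, Q₂] at h
  rw [withDensity_apply _ hE, Measure.map_apply measurable_add_dirac hE,
    Measure.prod_apply (measurable_add_dirac hE)] at h
  exact h

/-- The Mecke equation. -/
theorem IsPoissonLaw.mecke [PseudoMetricSpace W] [OpensMeasurableSpace W]
    [SigmaFinite ν] [IsProbabilityMeasure P] (hP : IsPoissonLaw P ν)
    {F : W → Measure W → ℝ≥0∞} (hF : Measurable (Function.uncurry F)) :
    ∫⁻ m, ∫⁻ x, F x m ∂m ∂P = ∫⁻ x, ∫⁻ m, F x (m + Measure.dirac x) ∂P ∂ν := by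
  have hadd : Measurable fun p : W × Measure W => (p.1, p.2 + Measure.dirac p.1) :=
    measurable_fst.prodMk measurable_add_dirac
  -- The two sides of the equation as measures on pairs; they are compared on rectangles.
  let R₁ : Measure (W × Measure W) := (P ⊗ₘ evalKernel ν).map Prod.swap
  let R₂ : Measure (W × Measure W) := (ν.prod P).map fun p => (p.1, p.2 + Measure.dirac p.1)
  have h₁ : ∀ A E, MeasurableSet A → MeasurableSet E → R₁ (A ×ˢ E) = ∫⁻ m in E, m A ∂P := by
    intro A E hA hE
    rw [Measure.map_apply measurable_swap (hA.prod hE), Set.preimage_swap_prod,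
      Measure.compProd_apply_prod hE hA]
    refine lintegral_congr_ae ?_
    filter_upwards [ae_restrict_of_ae hP.ae_mem_finiteOnSpanningSets] with m hm
    rw [evalKernel_apply hm]
  have h₂ : ∀ A E, MeasurableSet A → MeasurableSet E →
      R₂ (A ×ˢ E) = ∫⁻ x in A, P {m | m + Measure.dirac x ∈ E} ∂ν := by
    intro A E hA hE
    rw [Measure.map_apply hadd (hA.prod hE), Measure.prod_apply (hadd (hA.prod hE)),
      ← lintegral_indicator hA]
    refine lintegral_congr fun x => ?_
    by_cases hx : x ∈ A <;> simp [hx, Set.preimage]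
  have hfin : ∀ k, ν (spanningSets ν k) ≠ ∞ := fun k => (measure_spanningSets_lt_top ν k).ne
  have hB := measurableSet_spanningSets ν
  have hR : R₁ = R₂ := by
    have hspan : R₁.FiniteSpanningSetsIn
        (Set.image2 (· ×ˢ ·) {s : Set W | MeasurableSet s} {t : Set (Measure W) | MeasurableSet t}) :=
      { set := fun k => spanningSets ν k ×ˢ Set.univ
        set_mem := fun k => by
          have hu : MeasurableSet (Set.univ : Set (Measure W)) := .univ
          exact ⟨_, hB k, _, hu, rfl⟩
        finite := fun k => by
          rw [h₁ _ _ (hB k) .univ, Measure.restrict_univ]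
          exact (hP.lintegral_apply_ne_top _ (hB k) (hfin k)).lt_top
        spanning := by
          rw [← Set.iUnion_prod_const, iUnion_spanningSets, Set.univ_prod_univ] }
    refine hspan.ext generateFrom_prod.symm isPiSystem_prod ?_
    rintro _ ⟨A, hA, E, hE, rfl⟩
    -- The rectangle formula needs ν A finite, so a general A is exhausted first.
    have hmono : Monotone fun k => (A ∩ spanningSets ν k) ×ˢ E := fun i j hij =>
      Set.prod_mono_left (Set.inter_subset_inter_right _ (monotone_spanningSets ν hij))
    have hun : A ×ˢ E = ⋃ k, (A ∩ spanningSets ν k) ×ˢ E := by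
      rw [← Set.iUnion_prod_const, ← Set.inter_iUnion, iUnion_spanningSets, Set.inter_univ]
    simp only
    rw [hun, hmono.measure_iUnion, hmono.measure_iUnion]
    refine iSup_congr fun k => ?_
    have hAk : MeasurableSet (A ∩ spanningSets ν k) := MeasurableSet.inter hA (hB k)
    rw [h₁ _ _ hAk hE, h₂ _ _ hAk hE, hP.lintegral_apply_mul_indicator hAk
      (measure_ne_top_of_subset Set.inter_subset_right (hfin k)) hE]
  have h := congrArg (fun R => lintegral R (Function.uncurry F)) hR
  simp only [R₁, R₂] at h
  rw [lintegral_map hF measurable_swap, lintegral_map hF hadd] at h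
  have h₃ := Measure.lintegral_compProd (μ := P) (κ := evalKernel ν) (hF.comp measurable_swap)
  have h₄ := lintegral_prod (μ := ν) (ν := P) _ (hF.comp hadd).aemeasurable
  refine Eq.trans (lintegral_congr_ae ?_) (h₃.symm.trans (h.trans h₄))
  filter_upwards [hP.ae_mem_finiteOnSpanningSets] with m hm
  rw [evalKernel_apply hm]
  rfl

end Mecke

/-! ### Measurability in a parameter, and product kernels -/

/-- Supplies the measurability behind each `Measure.bind`: the map pushed along may itself depend on
the parameter. -/
lemma measurable_map_prodMk {α β γ : Type*} [MeasurableSpace α] [MeasurableSpace β]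
    [MeasurableSpace γ] (κ : Kernel α β) [IsSFiniteKernel κ] {g : α × β → γ} (hg : Measurable g) :
    Measurable fun a => (κ a).map fun b => g (a, b) := by
  refine Measure.measurable_of_measurable_coe _ fun s hs => ?_
  have : (fun a => ((κ a).map fun b => g (a, b)) s) = fun a => κ a (Prod.mk a ⁻¹' (g ⁻¹' s)) := by
    funext a
    exact Measure.map_apply (hg.comp measurable_prodMk_left) hs
  rw [this]
  exact Kernel.measurable_kernel_prodMk_left (hg hs)

@[fun_prop]
lemma measurable_snoc {W : Type*} [MeasurableSpace W] {n : ℕ} :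
    Measurable fun p : (Fin n → W) × W => (Fin.snoc p.1 p.2 : Fin (n + 1) → W) := by
  refine measurable_pi_lambda _ fun i => ?_
  refine Fin.lastCases ?_ (fun j => ?_) i
  · simpa using measurable_snd
  · simp only [Fin.snoc_castSucc]
    fun_prop

section PiKernel

variable {W : Type*} [MeasurableSpace W]

lemma pi_succ_eq_map_snoc (m : Measure W) [SigmaFinite m] (n : ℕ) :
    (Measure.pi fun _ : Fin (n + 1) => m) = ((Measure.pi fun _ : Fin n => m).prod m).map
      fun p => (Fin.snoc p.1 p.2 : Fin (n + 1) → W) := by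
  refine Measure.pi_eq fun s hs => ?_
  have hpre : (fun p : (Fin n → W) × W => (Fin.snoc p.1 p.2 : Fin (n + 1) → W)) ⁻¹'
      (Set.univ.pi s) = (Set.univ.pi fun i : Fin n => s i.castSucc) ×ˢ s (Fin.last n) := by
    ext p
    simp [Fin.forall_fin_succ']
  rw [Measure.map_apply measurable_snoc (.univ_pi hs), hpre, Measure.prod_prod, Measure.pi_pi,
    Fin.prod_univ_castSucc]

/-- The kernel sending a measure `m` to its `n`-fold product, cut off to zero (for `n > 0`) where
`m` is not finite on the sets `spanningSets ν k`. -/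
noncomputable def piKernel (ν : Measure W) [SigmaFinite ν] :
    (n : ℕ) → Kernel (Measure W) (Fin n → W)
  | 0 => Kernel.const _ (Measure.dirac Fin.elim0)
  | n + 1 => (piKernel ν n ×ₖ evalKernel ν).map fun p => (Fin.snoc p.1 p.2 : Fin (n + 1) → W)

instance (ν : Measure W) [SigmaFinite ν] (n : ℕ) : IsSFiniteKernel (piKernel ν n) := by
  induction n with
  | zero => rw [piKernel]; infer_instance
  | succ n ih => rw [piKernel]; infer_instance

lemma piKernel_apply {ν : Measure W} [SigmaFinite ν] {m : Measure W}
    (hm : m ∈ finiteOnSpanningSets ν) (n : ℕ) :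
    piKernel ν n m = Measure.pi fun _ => m := by
  have := sigmaFinite_of_mem_finiteOnSpanningSets hm
  induction n with
  | zero =>
    rw [piKernel, Kernel.const_apply, Measure.pi_of_empty]
    congr 1
  | succ n ih =>
    rw [piKernel, Kernel.map_apply _ measurable_snoc, Kernel.prod_apply, ih, evalKernel_apply hm,
      pi_succ_eq_map_snoc]

end PiKernel

/-! ### Distinct values, the sequential measure and the Palm laws -/

section Tie

variable {W : Type*} {n : ℕ}

lemma mem_distinctValues {w : Fin n → W} {x : W} : x ∈ distinctValues w ↔ x ∈ Set.range w := by
  simp [distinctValues]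

open Classical in
lemma distinctValues_snoc (w : Fin n → W) (x : W) :
    distinctValues (Fin.snoc w x : Fin (n + 1) → W) = insert x (distinctValues w) := by
  ext y
  simp [mem_distinctValues, eq_comm]

variable [MeasurableSpace W]

lemma tieMeasure_snoc_of_mem {w : Fin n → W} {x : W} (hx : x ∈ Set.range w) :
    tieMeasure (Fin.snoc w x : Fin (n + 1) → W) = tieMeasure w := by
  classical
  rw [tieMeasure, distinctValues_snoc, Finset.insert_eq_of_mem (mem_distinctValues.2 hx)]
  rfl

lemma tieMeasure_snoc_of_notMem {w : Fin n → W} {x : W} (hx : x ∉ Set.range w) :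
    tieMeasure (Fin.snoc w x : Fin (n + 1) → W) = Measure.dirac x + tieMeasure w := by
  classical
  rw [tieMeasure, distinctValues_snoc, Finset.sum_insert (mt mem_distinctValues.1 hx)]
  rfl

lemma lintegral_tieMeasure (w : Fin n → W) {f : W → ℝ≥0∞} (hf : Measurable f) :
    ∫⁻ x, f x ∂(tieMeasure w) = ∑ x ∈ distinctValues w, f x := by
  rw [tieMeasure, lintegral_finsetSum_measure]
  exact Finset.sum_congr rfl fun x _ => lintegral_dirac' _ hf

lemma tieMeasure_univ_le (w : Fin n → W) : tieMeasure w Set.univ ≤ n := by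
  classical
  rw [tieMeasure, Measure.finsetSum_apply]
  simp only [measure_univ, Finset.sum_const, nsmul_eq_mul, mul_one]
  have : (distinctValues w).card ≤ n := by
    simpa [distinctValues] using Finset.card_image_le (s := (Finset.univ : Finset (Fin n))) (f := w)
  exact_mod_cast this

instance (w : Fin n → W) : IsFiniteMeasure (tieMeasure w) :=
  ⟨(tieMeasure_univ_le w).trans_lt (ENNReal.natCast_lt_top n)⟩

lemma lintegral_palmLaw (P : Measure (Measure W)) (w : Fin n → W) {F : Measure W → ℝ≥0∞}
    (hF : Measurable F) :
    ∫⁻ m, F m ∂(palmLaw P w) = ∫⁻ m, F (m + tieMeasure w) ∂P :=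
  lintegral_map hF (measurable_id.add_const _)

variable [MeasurableEq W]

lemma measurableSet_setOf_last_mem_range :
    MeasurableSet {w : Fin (n + 1) → W | w (Fin.last n) ∈ Set.range (Fin.init w)} := by
  have : {w : Fin (n + 1) → W | w (Fin.last n) ∈ Set.range (Fin.init w)} =
      ⋃ i : Fin n, {w | w i.castSucc = w (Fin.last n)} := by
    ext w
    simp [Fin.init]
  rw [this]
  exact MeasurableSet.iUnion fun i =>
    measurableSet_eq_fun (measurable_pi_apply _) (measurable_pi_apply _)

-- By induction on the length: the last coordinate adds its Dirac mass exactly when it is new, and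
-- the set of repeats is a finite union of measurable diagonals.
@[fun_prop]
lemma measurable_tieMeasure : Measurable (tieMeasure : (Fin n → W) → Measure W) := by
  classical
  induction n with
  | zero =>
    have : (tieMeasure : (Fin 0 → W) → Measure W) = fun _ => 0 := by
      funext w
      simp [tieMeasure, distinctValues]
    rw [this]
    exact measurable_const
  | succ n ih =>
    have : (tieMeasure : (Fin (n + 1) → W) → Measure W) = fun w =>
        (if w (Fin.last n) ∈ Set.range (Fin.init w) then 0 else Measure.dirac (w (Fin.last n))) +
          tieMeasure (Fin.init w : Fin n → W) := by
      funext w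
      conv_lhs => rw [← Fin.snoc_init_self w]
      split_ifs with h
      · rw [tieMeasure_snoc_of_mem h, zero_add]
      · rw [tieMeasure_snoc_of_notMem h]
    rw [this]
    refine Measurable.add (Measurable.ite measurableSet_setOf_last_mem_range measurable_const
      (Measure.measurable_dirac.comp (measurable_pi_apply _))) (ih.comp ?_)
    exact measurable_pi_lambda _ fun i => measurable_pi_apply _

/-- The kernel `w ↦ ν + ∑ⱼ δ_{Wⱼ*}`. -/
noncomputable def urnKernel (ν : Measure W) (n : ℕ) : Kernel (Fin n → W) W :=
  Kernel.const _ ν + ⟨tieMeasure, measurable_tieMeasure⟩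

instance (ν : Measure W) [SFinite ν] : IsSFiniteKernel (urnKernel ν n) := by
  have : IsFiniteKernel (⟨tieMeasure, measurable_tieMeasure⟩ : Kernel (Fin n → W) W) :=
    ⟨⟨n, ENNReal.natCast_lt_top n, fun w => tieMeasure_univ_le w⟩⟩
  rw [urnKernel]
  infer_instance

lemma lintegral_urnMeasure_succ (ν : Measure W) [SFinite ν] {F : (Fin (n + 1) → W) → ℝ≥0∞}
    (hF : Measurable F) :
    ∫⁻ w, F w ∂(urnMeasure ν (n + 1)) =
      ∫⁻ w, ∫⁻ x, F (Fin.snoc w x : Fin (n + 1) → W) ∂(ν + tieMeasure w) ∂(urnMeasure ν n) := by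
  have hmeas : Measurable fun w : Fin n → W =>
      (ν + tieMeasure w).map fun x => (Fin.snoc w x : Fin (n + 1) → W) :=
    measurable_map_prodMk (urnKernel ν n) measurable_snoc
  rw [urnMeasure, Measure.lintegral_bind hmeas.aemeasurable hF.aemeasurable]
  exact lintegral_congr fun w => lintegral_map hF (measurable_snoc.comp measurable_prodMk_left)

variable (P : Measure (Measure W))

lemma measurable_prodMk_add_tieMeasure :
    Measurable fun p : (Fin n → W) × Measure W => (p.1, p.2 + tieMeasure p.1) :=
  measurable_fst.prodMk (measurable_snd.add (measurable_tieMeasure.comp measurable_fst))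

lemma measurable_palmLaw [SFinite P] : Measurable fun w : Fin n → W => palmLaw P w :=
  measurable_map_prodMk (Kernel.const _ P) (measurable_snd.comp measurable_prodMk_add_tieMeasure)

lemma lintegral_disintegration [SFinite P] (M : Measure (Fin n → W))
    {F : (Fin n → W) × Measure W → ℝ≥0∞} (hF : Measurable F) :
    ∫⁻ p, F p ∂(disintegration M (palmLaw P)) =
      ∫⁻ w, ∫⁻ m, F (w, m + tieMeasure w) ∂P ∂M := by
  have hmap : (fun w : Fin n → W => (palmLaw P w).map fun m => (w, m)) =
      fun w => P.map fun m => (w, m + tieMeasure w) := by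
    funext w
    exact Measure.map_map measurable_prodMk_left (measurable_id.add_const _)
  have hmeas : Measurable fun w : Fin n → W => P.map fun m => (w, m + tieMeasure w) :=
    measurable_map_prodMk (Kernel.const (Fin n → W) P) measurable_prodMk_add_tieMeasure
  rw [disintegration, hmap, Measure.lintegral_bind hmeas.aemeasurable hF.aemeasurable]
  exact lintegral_congr fun w =>
    lintegral_map hF (measurable_prodMk_add_tieMeasure.comp measurable_prodMk_left)

end Tie

/-! ### The disintegration in sequential form -/

section Joint

variable {W : Type*} [MeasurableSpace W] {P : Measure (Measure W)} {ν : Measure W} {n : ℕ}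

lemma IsPoissonLaw.piKernel_ae_eq [SigmaFinite ν] (hP : IsPoissonLaw P ν) (n : ℕ) :
    ∀ᵐ m ∂P, piKernel ν n m = Measure.pi fun _ => m :=
  hP.ae_mem_finiteOnSpanningSets.mono fun _ hm => piKernel_apply hm n

/-- Almost every m is finite on the spanning sets, and there the product measure is the value of a
genuine kernel. -/
lemma IsPoissonLaw.aemeasurable_pi [SigmaFinite ν] (hP : IsPoissonLaw P ν) (n : ℕ) :
    AEMeasurable (fun m : Measure W => Measure.pi fun _ : Fin n => m) P :=
  ⟨piKernel ν n, (piKernel ν n).measurable, (hP.piKernel_ae_eq n).mono fun _ h => h.symm⟩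

lemma IsPoissonLaw.lintegral_jointMeasure [SigmaFinite ν] (hP : IsPoissonLaw P ν)
    {F : (Fin n → W) × Measure W → ℝ≥0∞} (hF : Measurable F) :
    ∫⁻ p, F p ∂(jointMeasure n P) = ∫⁻ m, ∫⁻ w, F (w, m) ∂(piKernel ν n m) ∂P := by
  have hmeas : Measurable fun m => (piKernel ν n m).map fun w => (w, m) :=
    measurable_map_prodMk (piKernel ν n) measurable_swap
  rw [jointMeasure, Measure.lintegral_bind ⟨_, hmeas, (hP.piKernel_ae_eq n).mono fun m h => by
    simp only [h]⟩ hF.aemeasurable]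
  refine lintegral_congr_ae ((hP.piKernel_ae_eq n).mono fun m h => ?_)
  simp only
  rw [lintegral_map hF measurable_prodMk_right, h]

/-- The iterated Mecke equation. -/
theorem IsPoissonLaw.lintegral_piKernel [PseudoMetricSpace W] [OpensMeasurableSpace W]
    [MeasurableEq W] [SigmaFinite ν] [IsProbabilityMeasure P] (hP : IsPoissonLaw P ν)
    (hν : ∀ x : W, ν {x} = 0) {F : (Fin n → W) × Measure W → ℝ≥0∞} (hF : Measurable F) :
    ∫⁻ m, ∫⁻ w, F (w, m) ∂(piKernel ν n m) ∂P =
      ∫⁻ w, ∫⁻ m, F (w, m + tieMeasure w) ∂P ∂(urnMeasure ν n) := by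
  induction n with
  | zero =>
    have h0 : tieMeasure (Fin.elim0 : Fin 0 → W) = 0 := by simp [tieMeasure, distinctValues]
    have hm : Measurable fun w : Fin 0 → W => ∫⁻ m, F (w, m + tieMeasure w) ∂P :=
      (hF.comp measurable_prodMk_add_tieMeasure).lintegral_prod_right'
    rw [urnMeasure, lintegral_dirac' _ hm]
    refine lintegral_congr fun m => ?_
    have hFm : Measurable fun w => F (w, m) := hF.comp measurable_prodMk_right
    rw [piKernel, Kernel.const_apply, lintegral_dirac' _ hFm, h0, add_zero]
  | succ n ih =>
    -- Integrating out the last coordinate leaves a function of n points and m, to which the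
    -- induction hypothesis applies.
    let H : (Fin n → W) × Measure W → ℝ≥0∞ := fun p =>
      ∫⁻ x, F ((Fin.snoc p.1 x : Fin (n + 1) → W), p.2) ∂(evalKernel ν p.2)
    have hsn : Measurable fun q : ((Fin n → W) × Measure W) × W =>
        ((Fin.snoc q.1.1 q.2 : Fin (n + 1) → W), q.1.2) :=
      (measurable_snoc.comp ((measurable_fst.comp measurable_fst).prodMk measurable_snd)).prodMk
        (measurable_snd.comp measurable_fst)
    have hH : Measurable H :=
      (hF.comp hsn).lintegral_kernel_prod_right' (κ := (evalKernel ν).comap _ measurable_snd)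
    have hΦ : Measurable fun w : Fin (n + 1) → W => ∫⁻ m, F (w, m + tieMeasure w) ∂P :=
      (hF.comp measurable_prodMk_add_tieMeasure).lintegral_prod_right'
    have hL : ∀ m, ∫⁻ w, F (w, m) ∂(piKernel ν (n + 1) m) = ∫⁻ w, H (w, m) ∂(piKernel ν n m) := by
      intro m
      have hFm : Measurable fun w => F (w, m) := hF.comp measurable_prodMk_right
      rw [piKernel, Kernel.lintegral_map _ measurable_snoc _ hFm]
      exact Kernel.lintegral_prod _ _ _ (hFm.comp measurable_snoc)
    simp_rw [hL]
    rw [ih hH, lintegral_urnMeasure_succ ν hΦ]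
    refine lintegral_congr fun w => ?_
    have hFw : Measurable fun p : W × Measure W =>
        F ((Fin.snoc w p.1 : Fin (n + 1) → W), p.2 + tieMeasure w) :=
      hF.comp ((measurable_snoc.comp (measurable_const.prodMk measurable_fst)).prodMk
        (measurable_snd.add_const _))
    -- The last point is drawn from m + `tieMeasure w`: Mecke handles the part from m, while the
    -- other part is a finite sum.
    have hsplit : ∫⁻ m, H (w, m + tieMeasure w) ∂P =
        ∫⁻ m, ∫⁻ x, F ((Fin.snoc w x : Fin (n + 1) → W), m + tieMeasure w) ∂m ∂P +
        ∫⁻ m, ∫⁻ x, F ((Fin.snoc w x : Fin (n + 1) → W), m + tieMeasure w) ∂(tieMeasure w) ∂P := by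
      rw [← lintegral_add_right _ (Measurable.lintegral_prod_left' hFw)]
      refine lintegral_congr_ae (hP.ae_mem_finiteOnSpanningSets.mono fun m hm => ?_)
      simp only [H]
      rw [evalKernel_apply (add_mem_finiteOnSpanningSets hm), lintegral_add_measure]
    rw [hsplit, lintegral_add_measure, hP.mecke
      (F := fun x m => F ((Fin.snoc w x : Fin (n + 1) → W), m + tieMeasure w)) hFw]
    congr 1
    -- Without atoms, ν does not charge the finitely many old values, so the Dirac mass added by
    -- Mecke is a new term of the tie measure.
    · have hae : ∀ᵐ x ∂ν, x ∉ Set.range w :=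
        have : NullSingletonClass ν := ⟨hν⟩
        measure_eq_zero_iff_ae_notMem.1 ((Set.finite_range w).measure_zero ν)
      refine lintegral_congr_ae (hae.mono fun x hx => ?_)
      simp only
      rw [tieMeasure_snoc_of_notMem hx]
      simp_rw [add_assoc]
    -- A repeated value leaves the tie measure unchanged, so no Dirac mass is added.
    · rw [lintegral_lintegral_swap
        (f := fun m x => F ((Fin.snoc w x : Fin (n + 1) → W), m + tieMeasure w))
        (hFw.comp measurable_swap).aemeasurable]
      have hΦw : Measurable fun x =>
          ∫⁻ m, F ((Fin.snoc w x : Fin (n + 1) → W), m + tieMeasure w) ∂P :=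
        hFw.lintegral_prod_right'
      rw [lintegral_tieMeasure _ hΦw]
      refine Eq.trans ?_ (lintegral_tieMeasure _
        (hΦ.comp (measurable_snoc.comp measurable_prodMk_left))).symm
      refine Finset.sum_congr rfl fun x hx => ?_
      simp only [Function.comp_apply]
      rw [tieMeasure_snoc_of_mem (mem_distinctValues.1 hx)]

theorem IsPoissonLaw.jointMeasure_eq [PseudoMetricSpace W] [OpensMeasurableSpace W]
    [MeasurableEq W] [SigmaFinite ν] [IsProbabilityMeasure P] (hP : IsPoissonLaw P ν)
    (hν : ∀ x : W, ν {x} = 0) (n : ℕ) :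
    jointMeasure n P = disintegration (urnMeasure ν n) (palmLaw P) :=
  Measure.ext_of_lintegral _ fun F hF => by
    rw [hP.lintegral_jointMeasure hF, hP.lintegral_piKernel hν hF, lintegral_disintegration P _ hF]

theorem IsPoissonLaw.momentMeasure_eq_urnMeasure [PseudoMetricSpace W] [OpensMeasurableSpace W]
    [MeasurableEq W] [SigmaFinite ν] [IsProbabilityMeasure P] (hP : IsPoissonLaw P ν)
    (hν : ∀ x : W, ν {x} = 0) (n : ℕ) :
    momentMeasure n P = urnMeasure ν n :=
  Measure.ext_of_lintegral _ fun F hF => by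
    have hF' : Measurable fun p : (Fin n → W) × Measure W => F p.1 := hF.comp measurable_fst
    have h := hP.lintegral_piKernel hν hF'
    simp only [lintegral_const, measure_univ, mul_one] at h
    rw [momentMeasure, Measure.lintegral_bind (hP.aemeasurable_pi n) hF.aemeasurable, ← h]
    exact lintegral_congr_ae ((hP.piKernel_ae_eq n).mono fun m hm => by simp only [hm])

end Joint

/-! ### Sums over set partitions -/

/-- Recursion for sums over partitions: split off the cell containing a new element. -/
lemma sum_finpartition_insert {ι R : Type*} [DecidableEq ι] [CommSemiring R] {s : Finset ι} {x : ι}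
    (hx : x ∉ s) (a : Finset ι → R) :
    ∑ p : Finpartition (insert x s), ∏ C ∈ p.parts, a C =
      ∑ t ∈ s.powerset, a (insert x t) * ∑ q : Finpartition (s \ t), ∏ C ∈ q.parts, a C := by
  simp_rw [Finset.mul_sum]
  rw [Finset.sum_sigma']
  symm
  have hdisj : ∀ t, Disjoint (s \ t) (insert x t) := fun t => by
    rw [Finset.disjoint_insert_right]
    exact ⟨fun h => hx (Finset.mem_sdiff.1 h).1, Finset.sdiff_disjoint⟩
  have hsup : ∀ t ∈ s.powerset, (s \ t) ⊔ insert x t = insert x s := fun t ht => by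
    rw [Finset.sup_eq_union, Finset.union_insert, Finset.sdiff_union_of_subset (Finset.mem_powerset.1 ht)]
  have hnot : ∀ t (q : Finpartition (s \ t)) u, insert x u ∉ q.parts := fun t q u h =>
    hx (Finset.mem_sdiff.1 (q.le h (Finset.mem_insert_self x u))).1
  have hpow : ∀ y : (t : Finset ι) × Finpartition (s \ t),
      y ∈ s.powerset.sigma (fun t => (Finset.univ : Finset (Finpartition (s \ t)))) →
      y.1 ∈ s.powerset := fun y hy => (Finset.mem_sigma.1 hy).1
  -- The pair (t, q) corresponds to q with the cell {x} ∪ t adjoined; the inverse removes the cell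
  -- of x.
  refine Finset.sum_bij (fun y hy => y.2.extend (b := insert x y.1) (Finset.insert_ne_empty x y.1)
    (hdisj y.1) (hsup y.1 (hpow y hy))) (fun _ _ => Finset.mem_univ _) ?_ ?_ ?_
  · rintro ⟨t, q⟩ hy ⟨t', q'⟩ hy' h
    have hparts : insert (insert x t) q.parts = insert (insert x t') q'.parts :=
      congrArg Finpartition.parts h
    have hxt : ∀ t ∈ s.powerset, x ∉ t := fun t ht hxt => hx (Finset.mem_powerset.1 ht hxt)
    have htt : t = t' := by
      have hmem : insert x t ∈ insert (insert x t') q'.parts :=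
        hparts ▸ Finset.mem_insert_self _ _
      rcases Finset.mem_insert.1 hmem with h' | h'
      · rw [← Finset.erase_insert (hxt t (hpow _ hy)), h', Finset.erase_insert (hxt t' (hpow _ hy'))]
      · exact absurd h' (hnot t' q' t)
    subst htt
    congr 1
    ext1
    rw [← Finset.erase_insert (hnot t q t), hparts, Finset.erase_insert (hnot t q' t)]
  · intro p _
    have hxp : x ∈ p.part x := p.mem_part_self.2 (Finset.mem_insert_self x s)
    have hpp : p.part x ∈ p.parts := p.part_mem.2 (Finset.mem_insert_self x s)
    have hsub : (p.part x).erase x ⊆ s := by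
      rw [← Finset.subset_insert_iff]
      exact p.part_subset x
    have hsup' : (p.parts.erase (p.part x)).sup id = s \ (p.part x).erase x := by
      ext i
      simp only [Finset.mem_sup, Finset.mem_erase, id, Finset.mem_sdiff]
      constructor
      · rintro ⟨C, ⟨hC, hCp⟩, hi⟩
        have hip : i ∉ p.part x := fun h => hC (p.eq_of_mem_parts hCp hpp hi h)
        refine ⟨?_, fun h => hip h.2⟩
        have hi' := p.le hCp hi
        rcases Finset.mem_insert.1 hi' with rfl | h
        · exact absurd hxp hip
        · exact h
      · rintro ⟨his, hi⟩
        have hne : i ≠ x := fun h => hx (h ▸ his)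
        have hi2 : i ∈ insert x s := Finset.mem_insert_of_mem his
        refine ⟨p.part i, ⟨fun h => hi ⟨hne, h ▸ p.mem_part_self.2 hi2⟩, p.part_mem.2 hi2⟩,
          p.mem_part_self.2 hi2⟩
    let q : Finpartition (s \ (p.part x).erase x) :=
      { parts := p.parts.erase (p.part x)
        supIndep := p.supIndep.subset (Finset.erase_subset _ _)
        sup_parts := hsup'
        bot_notMem := fun h => p.bot_notMem (Finset.mem_of_mem_erase h) }
    refine ⟨⟨(p.part x).erase x, q⟩,
      Finset.mem_sigma.2 ⟨Finset.mem_powerset.2 hsub, Finset.mem_univ _⟩, ?_⟩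
    ext1
    change insert (insert x ((p.part x).erase x)) (p.parts.erase (p.part x)) = p.parts
    rw [Finset.insert_erase hxp, Finset.insert_erase hpp]
  · rintro ⟨t, q⟩ hy
    exact (Finset.prod_insert (hnot t q t)).symm

lemma spread_preimage_pi {W : Type*} {n : ℕ}
    (p : Finpartition (Finset.univ : Finset (Fin n))) (A : Fin n → Set W) :
    (spread p : (p.parts → W) → Fin n → W) ⁻¹' Set.univ.pi A =
      Set.univ.pi fun C : p.parts => ⋂ i ∈ C.1, A i := by
  ext v
  simp only [Set.mem_preimage, Set.mem_pi, Set.mem_univ, true_implies, Set.mem_iInter, spread]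
  constructor
  · rintro h ⟨C, hC⟩ i hi
    have := h i
    simp only [p.part_eq_of_mem hC hi] at this
    exact this
  · intro h i
    exact h _ i (p.mem_part_self.2 (Finset.mem_univ i))

/-! ### Moments and the partition form of the moment measure -/

section Moments

variable {W : Type*} [MeasurableSpace W] {P : Measure (Measure W)} {ν : Measure W}

/-- The mixed moments of a Poisson random measure. -/
theorem IsPoissonLaw.lintegral_prod_lintegral [PseudoMetricSpace W] [OpensMeasurableSpace W]
    [SigmaFinite ν] [IsProbabilityMeasure P] (hP : IsPoissonLaw P ν) {ι : Type*} [DecidableEq ι]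
    (g : ι → W → ℝ≥0∞) (hg : ∀ i, Measurable (g i)) (s : Finset ι) :
    ∫⁻ m, ∏ i ∈ s, ∫⁻ x, g i x ∂m ∂P =
      ∑ p : Finpartition s, ∏ C ∈ p.parts, ∫⁻ x, ∏ i ∈ C, g i x ∂ν := by
  induction s using Finset.strongInduction with
  | H s ih =>
  rcases s.eq_empty_or_nonempty with rfl | ⟨x, hx⟩
  · have : ∀ p : Finpartition (∅ : Finset ι), p.parts = ∅ := fun p =>
      Finpartition.parts_eq_empty_iff.2 rfl
    simp only [Finset.prod_empty, lintegral_const, measure_univ, mul_one, this]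
    have h1 : Fintype.card (Finpartition (∅ : Finset ι)) = 1 :=
      Fintype.card_eq_one_iff.2 ⟨Finpartition.empty _, fun p => by
        ext1; rw [this]; rfl⟩
    simp [h1]
  · have hxs := Finset.notMem_erase x s
    have hs := Finset.insert_erase hx
    generalize s.erase x = s' at hxs hs
    subst hs
    have hGm : ∀ i, Measurable fun m : Measure W => ∫⁻ y, g i y ∂m := fun i =>
      Measure.measurable_lintegral (hg i)
    have hG : ∀ u : Finset ι, Measurable fun m : Measure W => ∏ i ∈ u, ∫⁻ y, g i y ∂m := fun u =>
      Finset.measurable_fun_prod _ fun i _ => hGm i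
    have hgm : ∀ u : Finset ι, Measurable fun y => ∏ i ∈ u, g i y := fun u =>
      Finset.measurable_fun_prod _ fun i _ => hg i
    have hxt : ∀ t ∈ s'.powerset, x ∉ t := fun t ht h => hxs (Finset.mem_powerset.1 ht h)
    -- The factor of index x supplies the integration against m that Mecke requires.
    calc ∫⁻ m, ∏ i ∈ insert x s', ∫⁻ y, g i y ∂m ∂P
        = ∫⁻ m, ∫⁻ y, g x y * ∏ i ∈ s', ∫⁻ y, g i y ∂m ∂m ∂P := by
          refine lintegral_congr fun m => ?_
          rw [Finset.prod_insert hxs, lintegral_mul_const _ (hg x)]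
      _ = ∫⁻ y, ∫⁻ m, g x y * ∏ i ∈ s', ∫⁻ z, g i z ∂(m + Measure.dirac y) ∂P ∂ν :=
          hP.mecke (F := fun y m => g x y * ∏ i ∈ s', ∫⁻ z, g i z ∂m)
            (((hg x).comp measurable_fst).mul ((hG s').comp measurable_snd))
      -- Each remaining factor becomes g_i(y) + m(g_i). In the expansion, t collects the indices
      -- evaluated at y, so {x} ∪ t is the cell of x.
      _ = ∫⁻ y, ∫⁻ m, ∑ t ∈ s'.powerset, (∏ i ∈ insert x t, g i y) *
            ∏ i ∈ s' \ t, ∫⁻ z, g i z ∂m ∂P ∂ν := by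
          refine lintegral_congr fun y => lintegral_congr fun m => ?_
          have : ∀ i, ∫⁻ z, g i z ∂(m + Measure.dirac y) = g i y + ∫⁻ z, g i z ∂m := fun i => by
            rw [lintegral_add_measure, lintegral_dirac' _ (hg i), add_comm]
          simp_rw [this]
          rw [Finset.prod_add, Finset.mul_sum]
          refine Finset.sum_congr rfl fun t ht => ?_
          rw [Finset.prod_insert (hxt t ht), mul_assoc]
      _ = ∑ t ∈ s'.powerset, (∫⁻ y, ∏ i ∈ insert x t, g i y ∂ν) *
            ∫⁻ m, ∏ i ∈ s' \ t, ∫⁻ z, g i z ∂m ∂P := by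
          have : ∀ y, ∫⁻ m, ∑ t ∈ s'.powerset, (∏ i ∈ insert x t, g i y) *
              ∏ i ∈ s' \ t, ∫⁻ z, g i z ∂m ∂P = ∑ t ∈ s'.powerset, (∏ i ∈ insert x t, g i y) *
              ∫⁻ m, ∏ i ∈ s' \ t, ∫⁻ z, g i z ∂m ∂P := fun y => by
            rw [lintegral_finsetSum _ fun t _ => (hG _).const_mul _]
            exact Finset.sum_congr rfl fun t _ => lintegral_const_mul _ (hG _)
          simp_rw [this]
          rw [lintegral_finsetSum _ fun t _ => (hgm _).mul_const _]
          exact Finset.sum_congr rfl fun t _ => lintegral_mul_const _ (hgm _)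
      _ = _ := by
          rw [sum_finpartition_insert hxs fun C => ∫⁻ y, ∏ i ∈ C, g i y ∂ν]
          refine Finset.sum_congr rfl fun t _ => ?_
          rw [ih (s' \ t) (Finset.sdiff_subset.trans_ssubset (Finset.ssubset_insert hxs))]

/-- By Fubini: with coordinate i frozen, the section is a hyperplane in coordinate j, which is null
as ν has no atoms. -/
lemma measure_pi_setOf_apply_eq_apply [MeasurableEq W] (ν : Measure W) [SigmaFinite ν]
    [NullSingletonClass ν] {ι : Type*} [Fintype ι] {i j : ι} (hij : i ≠ j) :
    (Measure.pi fun _ : ι => ν) {v | v i = v j} = 0 := by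
  classical
  let S : Set (({k : ι // k = i} → W) × ({k : ι // ¬ k = i} → W)) :=
    {q | q.1 ⟨i, rfl⟩ = q.2 ⟨j, hij.symm⟩}
  have hS : MeasurableSet S := measurableSet_eq_fun
    ((measurable_pi_apply _).comp measurable_fst) ((measurable_pi_apply _).comp measurable_snd)
  have hmp := measurePreserving_piEquivPiSubtypeProd (fun _ : ι => ν) (fun k => k = i)
  have hpre : MeasurableEquiv.piEquivPiSubtypeProd (fun _ : ι => W) (fun k => k = i) ⁻¹' S =
      {v | v i = v j} := rfl
  rw [← hpre, hmp.measure_preimage hS.nullMeasurableSet, Measure.measure_prod_null hS]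
  refine .of_forall fun u => ?_
  have h := Measure.pi_hyperplane (fun _ : {k : ι // ¬ k = i} => ν) ⟨j, hij.symm⟩ (u ⟨i, rfl⟩)
  refine Eq.trans (congrArg _ ?_) h
  ext w
  exact eq_comm

lemma ae_pi_injective [MeasurableEq W] (ν : Measure W) [SigmaFinite ν] [NullSingletonClass ν]
    {ι : Type*} [Fintype ι] :
    ∀ᵐ v ∂(Measure.pi fun _ : ι => ν), Function.Injective v := by
  have h : ∀ i j : ι, ∀ᵐ v ∂(Measure.pi fun _ : ι => ν), v i = v j → i = j := fun i j => by
    by_cases hij : i = j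
    · exact .of_forall fun _ _ => hij
    · have := measure_eq_zero_iff_ae_notMem.1 (measure_pi_setOf_apply_eq_apply ν hij)
      exact this.mono fun v hv h => absurd h hv
  have h' := ae_all_iff.2 fun i => ae_all_iff.2 (h i)
  exact h'.mono fun v hv i j hvij => hv i j hvij

variable {n : ℕ}

lemma measurable_spread (p : Finpartition (Finset.univ : Finset (Fin n))) :
    Measurable (spread p : (p.parts → W) → Fin n → W) :=
  measurable_pi_lambda _ fun _ => measurable_pi_apply _

/-- Almost every family is injective, so the restriction costs nothing, and `spread` pulls a box
back to a box with one side per cell. -/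
lemma partitionMeasure_pi [MeasurableEq W] (ν : Measure W) [SigmaFinite ν] [NullSingletonClass ν]
    {A : Fin n → Set W} (hA : ∀ i, MeasurableSet (A i)) :
    partitionMeasure ν n (Set.univ.pi A) =
      ∑ p : Finpartition (Finset.univ : Finset (Fin n)), ∏ C ∈ p.parts, ν (⋂ i ∈ C, A i) := by
  rw [partitionMeasure, Measure.finsetSum_apply]
  refine Finset.sum_congr rfl fun p _ => ?_
  rw [Measure.restrict_eq_self_of_ae_mem (s := {v | Function.Injective v}) (ae_pi_injective ν),
    Measure.map_apply (measurable_spread p) (.univ_pi hA), spread_preimage_pi, Measure.pi_pi,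
    Finset.prod_coe_sort p.parts fun C => ν (⋂ i ∈ C, A i)]

/-- The mixed moment formula for indicators: their product over a cell is the indicator of the
intersection. -/
lemma IsPoissonLaw.momentMeasure_pi [PseudoMetricSpace W] [OpensMeasurableSpace W]
    [SigmaFinite ν] [IsProbabilityMeasure P] (hP : IsPoissonLaw P ν)
    {A : Fin n → Set W} (hA : ∀ i, MeasurableSet (A i)) :
    momentMeasure n P (Set.univ.pi A) =
      ∑ p : Finpartition (Finset.univ : Finset (Fin n)), ∏ C ∈ p.parts, ν (⋂ i ∈ C, A i) := by
  have h := hP.lintegral_prod_lintegral (fun i => (A i).indicator 1)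
    (fun i => measurable_one.indicator (hA i)) Finset.univ
  have hprod : ∀ (C : Finset (Fin n)) x, ∏ i ∈ C, (A i).indicator (1 : W → ℝ≥0∞) x =
      (⋂ i ∈ C, A i).indicator 1 x := fun C x => by
    by_cases hx : x ∈ ⋂ i ∈ C, A i
    · rw [Set.indicator_of_mem hx]
      exact Finset.prod_eq_one fun i hi => Set.indicator_of_mem (Set.mem_iInter₂.1 hx i hi) _
    · rw [Set.indicator_of_notMem hx]
      obtain ⟨i, hi⟩ := not_forall.1 (mt Set.mem_iInter.2 hx)
      obtain ⟨hiC, hi⟩ := not_forall.1 (mt Set.mem_iInter.2 hi)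
      exact Finset.prod_eq_zero hiC (Set.indicator_of_notMem hi _)
  simp_rw [hprod] at h
  simp_rw [fun (C : Finset (Fin n)) =>
    lintegral_indicator_one (μ := ν) (C.measurableSet_biInter fun i _ => hA i)] at h
  rw [momentMeasure, Measure.bind_apply (.univ_pi hA) (hP.aemeasurable_pi n), ← h]
  refine lintegral_congr_ae (hP.ae_mem_finiteOnSpanningSets.mono fun m hm => ?_)
  have := sigmaFinite_of_mem_finiteOnSpanningSets hm
  simp only
  rw [Measure.pi_pi]
  exact Finset.prod_congr rfl fun i _ => (lintegral_indicator_one (hA i)).symm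

/-- The boxes over the sets `spanningSets ν k` have finite moment measure. -/
noncomputable def IsPoissonLaw.momentMeasureSpanningSets [PseudoMetricSpace W]
    [OpensMeasurableSpace W] [SigmaFinite ν] [IsProbabilityMeasure P] (hP : IsPoissonLaw P ν)
    (n : ℕ) : (momentMeasure n P).FiniteSpanningSetsIn
      (Set.pi Set.univ '' Set.pi Set.univ fun _ : Fin n => {s : Set W | MeasurableSet s}) where
  set k := Set.univ.pi fun _ => spanningSets ν k
  set_mem k := ⟨_, fun _ _ => measurableSet_spanningSets ν k, rfl⟩
  finite k := by
    rw [hP.momentMeasure_pi fun _ => measurableSet_spanningSets ν k]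
    refine ENNReal.sum_lt_top.2 fun p _ => ENNReal.prod_lt_top fun C hC => ?_
    -- Cells are nonempty, so each intersection lies in a set of finite measure.
    obtain ⟨i, hi⟩ := p.nonempty_of_mem_parts hC
    exact (measure_mono (Set.biInter_subset_of_mem hi)).trans_lt (measure_spanningSets_lt_top ν k)
  spanning := by
    refine Set.eq_univ_of_forall fun w => Set.mem_iUnion.2
      ⟨Finset.univ.sup fun i => spanningSetsIndex ν (w i), fun i _ => ?_⟩
    exact monotone_spanningSets ν
      (Finset.le_sup (f := fun i => spanningSetsIndex ν (w i)) (Finset.mem_univ i))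
      (mem_spanningSetsIndex ν (w i))

/-- Both measures give boxes the same mass; boxes form a π-system, and those over the spanning sets
exhaust the space with finite mass. -/
theorem IsPoissonLaw.momentMeasure_eq_partitionMeasure [PseudoMetricSpace W]
    [OpensMeasurableSpace W] [MeasurableEq W] [SigmaFinite ν] [IsProbabilityMeasure P]
    (hP : IsPoissonLaw P ν) (hν : ∀ x : W, ν {x} = 0) (n : ℕ) :
    momentMeasure n P = partitionMeasure ν n := by
  have : NullSingletonClass ν := ⟨hν⟩
  refine (hP.momentMeasureSpanningSets n).ext generateFrom_pi.symm isPiSystem_pi ?_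
  rintro _ ⟨A, hA, rfl⟩
  have hA' : ∀ i, MeasurableSet (A i) := fun i => hA i (Set.mem_univ i)
  rw [hP.momentMeasure_pi hA', partitionMeasure_pi ν hA']

lemma IsPoissonLaw.laplace_palmLaw (hP : IsPoissonLaw P ν) (w : Fin n → W) {f : W → ℝ≥0}
    (hf : Measurable f) :
    laplace (palmLaw P w) f = expNeg (∫⁻ x, (1 - expNeg (f x)) ∂ν) *
      ∏ x ∈ distinctValues w, expNeg (f x) := by
  have hf' : Measurable fun x => (f x : ℝ≥0∞) := hf.coe_nnreal_ennreal
  rw [laplace, lintegral_palmLaw _ _ (measurable_expNeg_lintegral hf'),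
    ← hP.lintegral_expNeg _ hf', ← lintegral_mul_const _ (measurable_expNeg_lintegral hf')]
  refine lintegral_congr fun m => ?_
  rw [lintegral_add_measure, expNeg_add, lintegral_tieMeasure _ hf', expNeg_sum]

end Moments

end PoissonPartition

theorem proposition2p2 {W : Type*} [MetricSpace W] [CompleteSpace W] [SecondCountableTopology W]
    [MeasurableSpace W] [BorelSpace W]
    {Ω : Type*} [MeasurableSpace Ω] (μ : Measure Ω) [IsProbabilityMeasure μ]
    (ν : Measure W) [SigmaFinite ν] (hν : ∀ x : W, ν {x} = 0)
    (N : Ω → Measure W) (hN : PoissonPartition.IsPoissonRandomMeasure N ν μ) (n : ℕ) :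
    -- the product measures and the laws `P(dN | ν, W)` depend measurably on `N` and on `W`
    AEMeasurable (fun m : Measure W => Measure.pi fun _ : Fin n => m) (μ.map N) ∧
    Measurable (fun w : Fin n → W => PoissonPartition.palmLaw (μ.map N) w) ∧
    -- the disintegration
    PoissonPartition.jointMeasure n (μ.map N) =
      PoissonPartition.disintegration (PoissonPartition.partitionMeasure ν n)
        (PoissonPartition.palmLaw (μ.map N)) ∧
    -- `P(dN | ν, W)` is the law of `N + ∑ⱼ δ_{Wⱼ*}` and is determined by its Laplace functional
    (∀ w : Fin n → W,
      PoissonPartition.palmLaw (μ.map N) w =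
        μ.map (fun ω => N ω + PoissonPartition.tieMeasure w) ∧
      IsProbabilityMeasure (PoissonPartition.palmLaw (μ.map N) w) ∧
      ∀ Q : Measure (Measure W), IsProbabilityMeasure Q →
        (Q = PoissonPartition.palmLaw (μ.map N) w ↔
          ∀ f ∈ PoissonPartition.BMPos W,
            PoissonPartition.laplace Q f =
              PoissonPartition.expNeg (∫⁻ x, (1 - PoissonPartition.expNeg (f x)) ∂ν) *
                ∏ x ∈ PoissonPartition.distinctValues w, PoissonPartition.expNeg (f x))) ∧
    -- the moment measure: partition form, sequential form, and the integrals of products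
    SigmaFinite (PoissonPartition.momentMeasure n (μ.map N)) ∧
    PoissonPartition.momentMeasure n (μ.map N) = PoissonPartition.partitionMeasure ν n ∧
    PoissonPartition.momentMeasure n (μ.map N) = PoissonPartition.urnMeasure ν n ∧
    (∀ g : Fin n → W → ℝ≥0∞, (∀ i, Measurable (g i)) →
      ∫⁻ m, ∏ i, ∫⁻ x, g i x ∂m ∂(μ.map N) =
        ∑ p : Finpartition (Finset.univ : Finset (Fin n)),
          ∏ C ∈ p.parts, ∫⁻ x, ∏ i ∈ C, g i x ∂ν) := by
  have hP := hN.isPoissonLaw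
  have : IsProbabilityMeasure (μ.map N) := Measure.isProbabilityMeasure_map hN.measurable.aemeasurable
  have hadd : ∀ w : Fin n → W, Measurable fun m : Measure W => m + PoissonPartition.tieMeasure w :=
    fun w => measurable_id.add_const _
  have hpart := hP.momentMeasure_eq_partitionMeasure hν n
  have hurn := hP.momentMeasure_eq_urnMeasure hν n
  refine ⟨hP.aemeasurable_pi n, PoissonPartition.measurable_palmLaw _, ?_, fun w => ?_,
    (hP.momentMeasureSpanningSets n).sigmaFinite, hpart, hurn,
    fun g hg => hP.lintegral_prod_lintegral g hg Finset.univ⟩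
  -- The partition and sequential forms agree because both are the moment measure, so the sequential
  -- disintegration suffices.
  · rw [← hpart, hurn]
    exact hP.jointMeasure_eq hν n
  · have hpr : IsProbabilityMeasure (PoissonPartition.palmLaw (μ.map N) w) :=
      Measure.isProbabilityMeasure_map (hadd w).aemeasurable
    refine ⟨Measure.map_map (hadd w) hN.measurable, hpr, fun Q hQ => ⟨?_, fun h => ?_⟩⟩
    · rintro rfl f hf
      exact hP.laplace_palmLaw w hf.1
    · exact PoissonPartition.ext_of_laplace fun f hf => by rw [h f hf, hP.laplace_palmLaw w hf.1]
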